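/- Let $k\ge 1$ and let $\Delta=(\mathbf p_0,\dots,\mathbf p_k)$ be an ordered $(k+1)$-tuple of affinely independent points of $\mathbb R^k$ (a non-degenerate simplex). Definitions. For $n\ge 1$ let $C_n(\mathbb R^k)$ be the space of $n$-tuples of distinct points of $\mathbb R^k$. For $\mathbf p\in C_n(\mathbb R^k)$ put $\pi_{ij}(\mathbf p)=\frac{\mathbf p_i-\mathbf p_j}{\|\mathbf p_i-\mathbf p_j\|}$ and $r_{ijl}(\mathbf p)=\frac{\|\mathbf p_i-\mathbf p_j\|}{\|\mathbf p_i-\mathbf p_l\|}$ (distinct indices), and let $\alpha_n(\mathbf p)=(\mathbf p,(\pi_{ij}(\mathbf p)),(r_{ijl}(\mathbf p)))\in A_n=(\mathbb R^k)^n\times(S^{k-1})^{n(n-1)}\times[0,\infty]^{n(n-1)(n-2)}$. For $M\subseteq\mathbb R^k$, $C_n[M]$ is the closure of $\alpha_n(C_n(\mathbb R^k)\cap M^n)$ in $M^n\times(S^{k-1})^{n(n-1)}\times[0,\infty]^{n(n-1)(n-2)}$; in particular $C_{k+1}[S^{k-1}]\subset C_{k+1}[\mathbb R^k]$ for the unit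 sphere $S^{k-1}\subset\mathbb R^k$. Let $\mathrm{Sim}(\Delta)\subset C_{k+1}[\mathbb R^k]$ be the closure of the set of all $\mathbf q\in C_{k+1}(\mathbb R^k)$ with $r_{ijl}(\mathbf q)=r_{ijl}(\Delta)$ for all distinct $i,j,l$. For a point $x\in C_{k+1}[\mathbb R^k]$ let $\Pi(x)$ be the $k\times k$ matrix with columns $\pi_{10}(x),\dots,\pi_{k0}(x)$ (the direction coordinates of $x$), and let $P(\Delta)=(\Pi(\Delta)^T\Pi(\Delta))^{1/2}$. The pose map $ps:\mathrm{Sim}(\Delta)\to O(k)$ sends $x$ to the unique orthogonal matrix $U$ with $\Pi(x)=U\,P(\Delta)$. Let $\mathrm{Sim}^+(\Delta)=ps^{-1}(SO(k))$, $\mathrm{Sim}^-(\Delta)=\mathrm{Sim}(\Delta)\setminus \mathrm{Sim}^+(\Delta)$, and $d=k(k-1)/2$. A top class of a closed $d$-manifold $M$ is a class in $H_d(M;\mathbb Z)$ whose image in $H_d(M,M\setminus\{x\};\mathbb Z)\cong\mathbb Z$ is a generator for every $x\in M$. Statement. (1) The pose map $ps:\mathrm{Sim}(\Delta)\cap C_{k+1}[S^{k-1}]\to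 O(k)$ and the inclusion $\mathrm{Sim}(\Delta)\cap C_{k+1}[S^{k-1}]\hookrightarrow \mathrm{Sim}(\Delta)$ induce isomorphisms on integral singular homology in every degree; in particular $H_*(O(k);\mathbb Z)\cong H_*(\mathrm{Sim}(\Delta)\cap C_{k+1}[S^{k-1}];\mathbb Z)$. (2) The intersection $X^+=\mathrm{Sim}^+(\Delta)\cap C_{k+1}[S^{k-1}]$ lies in the open configuration space $C_{k+1}(\mathbb R^k)$ and is a smooth $d$-dimensional submanifold of it, as is $SO(k)$ of the space of $k\times k$ matrices, and $ps:X^+\to SO(k)$ is a diffeomorphism. It induces an isomorphism on integral homology, as does the inclusion $\iota: X^+\hookrightarrow \mathrm{Sim}^+(\Delta)$, and it takes the top class of $X^+$ in $\mathrm{Sim}^+(\Delta)$ to the top class of $SO(k)$: for $c\in H_d(X^+;\mathbb Z)$, $c$ is a top class of $X^+$ if and only if $ps_*(\iota_*c)\in H_d(SO(k);\mathbb Z)$ is a top class of $SO(k)$. (3) The same holds for $X^-=\mathrm{Sim}^-(\Delta)\cap C_{k+1}[S^{k-1}]$, with $\mathrm{Sim}^-(\Delta)$ in place of $\mathrm{Sim}^+(\Delta)$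 and $O(k)\setminus SO(k)$ in place of $SO(k)$. -/

import Mathlib

open CategoryTheory AlgebraicTopology Limits Topology
open scoped ContDiff ENNReal MatrixOrder

noncomputable section

namespace InscribedSimplex

/-- Euclidean space `ℝ^k`. -/
abbrev E (k : ℕ) : Type := EuclideanSpace ℝ (Fin k)

/-! ### Configuration spaces and their compactifications -/

/-- The open configuration space `C_n(ℝ^k)` of ordered `n`-tuples of distinct points. -/
abbrev Conf (n k : ℕ) : Type := {p : Fin n → E k // Function.Injective p}

/-- Ordered pairs of distinct indices. -/
abbrev Pairs (n : ℕ) : Type := {t : Fin n × Fin n // t.1 ≠ t.2}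

/-- Ordered triples of pairwise distinct indices. -/
abbrev Triples (n : ℕ) : Type :=
  {t : Fin n × Fin n × Fin n // t.1 ≠ t.2.1 ∧ t.2.1 ≠ t.2.2 ∧ t.1 ≠ t.2.2}

/-- The product `A_n[ℝ^k] = (ℝ^k)^n × (S^{k-1})^{n(n-1)} × [0,∞]^{n(n-1)(n-2)}`. -/
abbrev Amb (n k : ℕ) : Type :=
  (Fin n → E k) × (Pairs n → Metric.sphere (0 : E k) 1) × (Triples n → ℝ≥0∞)

/-- The position coordinates of a point of `A_n[ℝ^k]`. -/
def pos {n k : ℕ} (x : Amb n k) : Fin n → E k := x.1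

/-- The unit vector `π_{ij}(p) = (p_i - p_j) / ‖p_i - p_j‖`. -/
def dir {n k : ℕ} (p : Conf n k) (t : Pairs n) : Metric.sphere (0 : E k) 1 :=
  ⟨‖p.1 t.1.1 - p.1 t.1.2‖⁻¹ • (p.1 t.1.1 - p.1 t.1.2), by
    have h : p.1 t.1.1 - p.1 t.1.2 ≠ 0 := sub_ne_zero.2 fun h => t.2 (p.2 h)
    rw [mem_sphere_zero_iff_norm, norm_smul, norm_inv, norm_norm,
      inv_mul_cancel₀ (norm_ne_zero_iff.2 h)]⟩

/-- The ratio `r_{ijl}(p) = ‖p_i - p_j‖ / ‖p_i - p_l‖`, as an element of `[0,∞]`. -/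
def ratio {n k : ℕ} (p : Conf n k) (t : Triples n) : ℝ≥0∞ :=
  ENNReal.ofReal (‖p.1 t.1.1 - p.1 t.1.2.1‖ / ‖p.1 t.1.1 - p.1 t.1.2.2‖)

/-- The map `α_n : C_n(ℝ^k) → A_n[ℝ^k]`. -/
def alpha {n k : ℕ} (p : Conf n k) : Amb n k := (p.1, dir p, ratio p)

/-- The compactified configuration space `C_n[M]` of a subset `M ⊆ ℝ^k`: the closure of
`C_n(M)` in `M^n × (S^{k-1})^{n(n-1)} × [0,∞]^{n(n-1)(n-2)}`. -/
def compactConf (n : ℕ) {k : ℕ} (M : Set (E k)) : Set (Amb n k) :=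
  {x | x ∈ closure (alpha '' {p : Conf n k | ∀ i, p.1 i ∈ M}) ∧ ∀ i, pos x i ∈ M}

/-- `C_{k+1}[S^{k-1}]` for the standard unit sphere of `ℝ^k`. -/
def sphereConf (k : ℕ) : Set (Amb (k + 1) k) := compactConf (k + 1) (Metric.sphere (0 : E k) 1)

/-! ### Similar simplices and the pose map -/

/-- The simplices similar to `Δ` in the open configuration space. -/
def simOpen {k : ℕ} (Δ : Conf (k + 1) k) : Set (Conf (k + 1) k) :=
  {q | ∀ t, ratio q t = ratio Δ t}

/-- `Sim(Δ)` as a closed subspace (with boundary) of `C_{k+1}[ℝ^k]`: the closure of the set of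
nondegenerate simplices similar to `Δ`. As `C_{k+1}[ℝ^k]` is closed in the ambient product, the
closure can be taken there. -/
def sim {k : ℕ} (Δ : Conf (k + 1) k) : Set (Amb (k + 1) k) := closure (alpha '' simOpen Δ)

/-- The matrix `Π(x) = [π_{10}(x) ⋯ π_{k0}(x)]`, whose columns are unit vectors. -/
def Pi {k : ℕ} (x : Amb (k + 1) k) : Matrix (Fin k) (Fin k) ℝ :=
  Matrix.of fun a j => (x.2.1 ⟨(j.succ, 0), Fin.succ_ne_zero j⟩ : E k) a

/-- `P(Δ) = (Π(Δ)ᵀ Π(Δ))^{1/2}`, the positive semidefinite square root. -/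
def P {k : ℕ} (Δ : Conf (k + 1) k) : Matrix (Fin k) (Fin k) ℝ :=
  CFC.sqrt ((Pi (alpha Δ)).transpose * Pi (alpha Δ))

/-- The pose `U(x) = Π(x) P(Δ)⁻¹`. For `x ∈ Sim(Δ)` it is the unique orthogonal matrix `U` with
`Π(x) = U P(Δ)`: see `pose_mul_P` and `pose_mem_orthogonalGroup`. -/
def pose {k : ℕ} (Δ : Conf (k + 1) k) (x : Amb (k + 1) k) : Matrix (Fin k) (Fin k) ℝ :=
  Pi x * (P Δ)⁻¹

theorem continuous_Pi {k : ℕ} : Continuous (Pi : Amb (k + 1) k → Matrix (Fin k) (Fin k) ℝ) := by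
  unfold Pi
  refine continuous_matrix fun a j => ?_
  simp only [Matrix.of_apply]
  fun_prop

theorem continuous_pose {k : ℕ} (Δ : Conf (k + 1) k) : Continuous (pose Δ) :=
  continuous_Pi.matrix_mul continuous_const

theorem Pi_transpose_mul_apply {k : ℕ} (x : Amb (k + 1) k) (i j : Fin k) :
    ((Pi x).transpose * Pi x) i j =
      inner ℝ (x.2.1 ⟨(i.succ, 0), Fin.succ_ne_zero i⟩ : E k)
        (x.2.1 ⟨(j.succ, 0), Fin.succ_ne_zero j⟩ : E k) := by
  simp [Matrix.mul_apply, Pi, PiLp.inner_apply, mul_comm]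

theorem ratio_toReal {n k : ℕ} (p : Conf n k) (t : Triples n) :
    (ratio p t).toReal = ‖p.1 t.1.1 - p.1 t.1.2.1‖ / ‖p.1 t.1.1 - p.1 t.1.2.2‖ :=
  ENNReal.toReal_ofReal (by positivity)

/-- The law of cosines, in terms of the ratios. -/
theorem inner_dir {k : ℕ} (q : Conf (k + 1) k) (i j : Fin k) (hij : i ≠ j) :
    inner ℝ (dir q ⟨(i.succ, 0), Fin.succ_ne_zero i⟩ : E k)
        (dir q ⟨(j.succ, 0), Fin.succ_ne_zero j⟩ : E k) =
      ((ratio q ⟨(0, i.succ, j.succ), (Fin.succ_ne_zero i).symm,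
          fun h => hij (Fin.succ_injective k h), (Fin.succ_ne_zero j).symm⟩).toReal +
        (ratio q ⟨(0, j.succ, i.succ), (Fin.succ_ne_zero j).symm,
          fun h => hij (Fin.succ_injective k h).symm, (Fin.succ_ne_zero i).symm⟩).toReal -
        (ratio q ⟨(i.succ, j.succ, 0), fun h => hij (Fin.succ_injective k h),
          Fin.succ_ne_zero j, Fin.succ_ne_zero i⟩).toReal *
        (ratio q ⟨(j.succ, i.succ, 0), fun h => hij (Fin.succ_injective k h).symm,
          Fin.succ_ne_zero i, Fin.succ_ne_zero j⟩).toReal) / 2 := by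
  simp only [ratio_toReal, dir, inner_smul_left, inner_smul_right]
  have hi : ‖q.1 i.succ - q.1 0‖ ≠ 0 :=
    norm_ne_zero_iff.2 (sub_ne_zero.2 fun h => Fin.succ_ne_zero i (q.2 h))
  have hj : ‖q.1 j.succ - q.1 0‖ ≠ 0 :=
    norm_ne_zero_iff.2 (sub_ne_zero.2 fun h => Fin.succ_ne_zero j (q.2 h))
  have h := norm_sub_sq_real (q.1 i.succ - q.1 0) (q.1 j.succ - q.1 0)
  rw [sub_sub_sub_cancel_right] at h
  rw [norm_sub_rev (q.1 0) (q.1 i.succ), norm_sub_rev (q.1 0) (q.1 j.succ),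
    norm_sub_rev (q.1 j.succ) (q.1 i.succ)]
  simp only [conj_trivial]
  field_simp
  linarith

/-- All points of `Sim(Δ)` have the same Gram matrix. -/
theorem gram_eq {k : ℕ} (Δ : Conf (k + 1) k) {x : Amb (k + 1) k} (hx : x ∈ sim Δ) :
    (Pi x).transpose * Pi x = (Pi (alpha Δ)).transpose * Pi (alpha Δ) := by
  have hc : IsClosed {x : Amb (k + 1) k |
      (Pi x).transpose * Pi x = (Pi (alpha Δ)).transpose * Pi (alpha Δ)} :=
    isClosed_eq (continuous_Pi.matrix_transpose.matrix_mul continuous_Pi) continuous_const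
  refine closure_minimal ?_ hc hx
  rintro _ ⟨q, hq, rfl⟩
  ext i j
  rw [Pi_transpose_mul_apply, Pi_transpose_mul_apply]
  by_cases hij : i = j
  · subst hij
    simp
  · change inner ℝ (dir q _ : E k) (dir q _ : E k) = inner ℝ (dir Δ _ : E k) (dir Δ _ : E k)
    rw [inner_dir q i j hij, inner_dir Δ i j hij, hq, hq, hq, hq]

theorem P_mul_P {k : ℕ} (Δ : Conf (k + 1) k) :
    P Δ * P Δ = (Pi (alpha Δ)).transpose * Pi (alpha Δ) := by
  refine CFC.sqrt_mul_sqrt_self _ ?_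
  rw [Matrix.nonneg_iff_posSemidef]
  simpa using Matrix.posSemidef_conjTranspose_mul_self (Pi (alpha Δ))

theorem P_transpose {k : ℕ} (Δ : Conf (k + 1) k) : (P Δ).transpose = P Δ := by
  have h : (P Δ).PosSemidef := Matrix.nonneg_iff_posSemidef.1 (CFC.sqrt_nonneg _)
  simpa using h.1.eq

theorem det_Pi_ne_zero {k : ℕ} (Δ : Conf (k + 1) k) (hΔ : AffineIndependent ℝ Δ.1) :
    (Pi (alpha Δ)).det ≠ 0 := by
  have h1 := (affineIndependent_iff_linearIndependent_vsub ℝ Δ.1 0).1 hΔ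
  have h2 : LinearIndependent ℝ fun j : Fin k => Δ.1 j.succ - Δ.1 0 :=
    h1.comp (fun j : Fin k => ⟨j.succ, Fin.succ_ne_zero j⟩)
      fun a b h => Fin.succ_injective k (congrArg Subtype.val h)
  have h3 : LinearIndependent ℝ fun j : Fin k =>
      ‖Δ.1 j.succ - Δ.1 0‖⁻¹ • (Δ.1 j.succ - Δ.1 0) := by
    have hne : ∀ j : Fin k, ‖Δ.1 j.succ - Δ.1 0‖⁻¹ ≠ 0 := fun j =>
      inv_ne_zero (norm_ne_zero_iff.2 (sub_ne_zero.2 fun h => Fin.succ_ne_zero j (Δ.2 h)))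
    exact h2.units_smul fun j => Units.mk0 _ (hne j)
  have h4 := h3.map' (WithLp.linearEquiv 2 ℝ (Fin k → ℝ)).toLinearMap (LinearEquiv.ker _)
  have h5 : LinearIndependent ℝ (Pi (alpha Δ)).col := h4
  have h6 := Matrix.linearIndependent_cols_iff_isUnit.1 h5
  exact ((Matrix.isUnit_iff_isUnit_det _).1 h6).ne_zero

theorem isUnit_det_P {k : ℕ} (Δ : Conf (k + 1) k) (hΔ : AffineIndependent ℝ Δ.1) :
    IsUnit (P Δ).det := by
  have h := congrArg Matrix.det (P_mul_P Δ)
  rw [Matrix.det_mul, Matrix.det_mul, Matrix.det_transpose] at h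
  refine isUnit_iff_ne_zero.2 fun h0 => ?_
  rw [h0, zero_mul] at h
  exact mul_self_ne_zero.2 (det_Pi_ne_zero Δ hΔ) h.symm

/-- The polar decomposition `Π(x) = U(x) P(Δ)`. -/
theorem pose_mul_P {k : ℕ} (Δ : Conf (k + 1) k) (hΔ : AffineIndependent ℝ Δ.1)
    (x : Amb (k + 1) k) : pose Δ x * P Δ = Pi x := by
  rw [pose, Matrix.mul_assoc, Matrix.nonsing_inv_mul _ (isUnit_det_P Δ hΔ), Matrix.mul_one]

theorem pose_mem_orthogonalGroup {k : ℕ} (Δ : Conf (k + 1) k) (hΔ : AffineIndependent ℝ Δ.1)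
    {x : Amb (k + 1) k} (hx : x ∈ sim Δ) : pose Δ x ∈ Matrix.orthogonalGroup (Fin k) ℝ := by
  have hu := isUnit_det_P Δ hΔ
  rw [Matrix.mem_orthogonalGroup_iff']
  change (Pi x * (P Δ)⁻¹).transpose * (Pi x * (P Δ)⁻¹) = 1
  rw [Matrix.transpose_mul, Matrix.transpose_nonsing_inv, P_transpose, Matrix.mul_assoc,
    ← Matrix.mul_assoc (Pi x).transpose, gram_eq Δ hx, ← P_mul_P, Matrix.mul_assoc,
    Matrix.mul_nonsing_inv _ hu, Matrix.mul_one, Matrix.nonsing_inv_mul _ hu]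

/-- `O(k)` as a subspace of the space of matrices. -/
def O (k : ℕ) : Set (Matrix (Fin k) (Fin k) ℝ) := Matrix.orthogonalGroup (Fin k) ℝ

/-- `SO(k)` as a subspace of the space of matrices. -/
def SO (k : ℕ) : Set (Matrix (Fin k) (Fin k) ℝ) := Matrix.specialOrthogonalGroup (Fin k) ℝ

/-- `Sim⁺(Δ)`: the similar simplices whose pose is a rotation. -/
def simPlus {k : ℕ} (Δ : Conf (k + 1) k) : Set (Amb (k + 1) k) :=
  {x | x ∈ sim Δ ∧ pose Δ x ∈ SO k}

/-- `Sim⁻(Δ) = Sim(Δ) \ Sim⁺(Δ)`. -/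
def simMinus {k : ℕ} (Δ : Conf (k + 1) k) : Set (Amb (k + 1) k) := sim Δ \ simPlus Δ

theorem mapsTo_pose {k : ℕ} (Δ : Conf (k + 1) k) (hΔ : AffineIndependent ℝ Δ.1) :
    Set.MapsTo (pose Δ) (sim Δ) (O k) := fun _ hx => pose_mem_orthogonalGroup Δ hΔ hx

theorem mapsTo_pose_plus {k : ℕ} (Δ : Conf (k + 1) k) :
    Set.MapsTo (pose Δ) (simPlus Δ) (SO k) := fun _ hx => hx.2

theorem mapsTo_pose_minus {k : ℕ} (Δ : Conf (k + 1) k) (hΔ : AffineIndependent ℝ Δ.1) :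
    Set.MapsTo (pose Δ) (simMinus Δ) (O k \ SO k) :=
  fun _ hx => ⟨pose_mem_orthogonalGroup Δ hΔ hx.1, fun h => hx.2 ⟨hx.1, h⟩⟩

/-- The pose map as a continuous map from a subspace `Y` to a space of matrices `T`. -/
def poseMap {k : ℕ} (Δ : Conf (k + 1) k) {Y : Set (Amb (k + 1) k)}
    {T : Set (Matrix (Fin k) (Fin k) ℝ)} (h : Set.MapsTo (pose Δ) Y T) : C(Y, T) :=
  ⟨h.restrict, (continuous_pose Δ).continuousOn.mapsToRestrict h⟩

/-- The inclusion of the inscribed configurations `Y ∩ C_{k+1}[S^{k-1}]` in `Y`. -/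
def incl {k : ℕ} (Y : Set (Amb (k + 1) k)) : C((Y ∩ sphereConf k : Set (Amb (k + 1) k)), Y) :=
  ⟨Set.inclusion Set.inter_subset_left, continuous_inclusion Set.inter_subset_left⟩

/-! ### Integral singular homology and fundamental classes -/

/-- The integral singular chain complex. -/
abbrev chains (X : Type) [TopologicalSpace X] : ChainComplex (ModuleCat.{0} ℤ) ℕ :=
  ((singularChainComplexFunctor (ModuleCat.{0} ℤ)).obj (ModuleCat.of ℤ ℤ)).obj (TopCat.of X)

/-- The chain map induced by a continuous map. -/
abbrev chainsMap {X Y : Type} [TopologicalSpace X] [TopologicalSpace Y] (f : C(X, Y)) :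
    chains X ⟶ chains Y :=
  ((singularChainComplexFunctor (ModuleCat.{0} ℤ)).obj (ModuleCat.of ℤ ℤ)).map (TopCat.ofHom f)

/-- Integral singular homology `H_n(X; ℤ)`. -/
abbrev H (n : ℕ) (X : Type) [TopologicalSpace X] : ModuleCat.{0} ℤ :=
  ((singularHomologyFunctor (ModuleCat.{0} ℤ) n).obj (ModuleCat.of ℤ ℤ)).obj (TopCat.of X)

/-- The map `f_*` induced by a continuous map on integral homology. -/
abbrev Hmap (n : ℕ) {X Y : Type} [TopologicalSpace X] [TopologicalSpace Y] (f : C(X, Y)) :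
    H n X ⟶ H n Y :=
  ((singularHomologyFunctor (ModuleCat.{0} ℤ) n).obj (ModuleCat.of ℤ ℤ)).map (TopCat.ofHom f)

/-- The relative singular chain complex of `(X, A)`. -/
def relChains (X : Type) [TopologicalSpace X] (A : Set X) : ChainComplex (ModuleCat.{0} ℤ) ℕ :=
  cokernel (chainsMap (⟨Subtype.val, continuous_subtype_val⟩ : C(A, X)))

/-- The natural map `H_n(X; ℤ) → H_n(X, A; ℤ)`. -/
def toRel (n : ℕ) (X : Type) [TopologicalSpace X] (A : Set X) :
    H n X ⟶ (relChains X A).homology n :=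
  HomologicalComplex.homologyMap
    (cokernel.π (chainsMap (⟨Subtype.val, continuous_subtype_val⟩ : C(A, X)))) n

/-- `c ∈ H_d(M; ℤ)` is a top class (fundamental class) of the closed `d`-manifold `M`: its image
in the local homology `H_d(M, M \ {x}; ℤ) ≅ ℤ` is a generator for every `x`. -/
def IsTopClass (d : ℕ) (M : Type) [TopologicalSpace M] (c : H d M) : Prop :=
  ∀ x : M, Submodule.span ℤ {(toRel d M {x}ᶜ).hom c} = ⊤

/-! ### Submanifolds of Euclidean space and diffeomorphisms between them -/

section Smooth

variable {M N F G : Type} [NormedAddCommGroup F] [NormedSpace ℝ F]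
  [NormedAddCommGroup G] [NormedSpace ℝ G]

/-- `e : M → F` identifies the space `M` with a `d`-dimensional smooth submanifold of the
normed space `F`: it is a topological embedding, and near each point its image is parametrized by
an open set `V` of `ℝ^d` through a smooth map `ψ` whose inverse is the restriction of a smooth
map `φ` defined on an open set of `F`. -/
def IsSmoothSubmanifold (d : ℕ) [TopologicalSpace M] (e : M → F) : Prop :=
  IsEmbedding e ∧ ∀ x : M, ∃ U : Set F, IsOpen U ∧ e x ∈ U ∧
    ∃ V : Set (E d), IsOpen V ∧ ∃ (ψ : E d → F) (φ : F → E d),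
      ContDiffOn ℝ ∞ ψ V ∧ ContDiffOn ℝ ∞ φ U ∧
      ψ '' V = Set.range e ∩ U ∧ ∀ v ∈ V, φ (ψ v) = v

/-- `f : M → N` is smooth with respect to `e : M → F` and `e' : N → G`: near every point it is the
restriction of a smooth map defined on an open set of `F`. -/
def IsSmoothMap (e : M → F) (e' : N → G) (f : M → N) : Prop :=
  ∀ x : M, ∃ U : Set F, IsOpen U ∧ e x ∈ U ∧ ∃ g : F → G, ContDiffOn ℝ ∞ g U ∧
    ∀ y : M, e y ∈ U → e' (f y) = g (e y)

/-- `f : M → N` is a bijection, smooth with smooth inverse. -/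
def IsDiffeo (e : M → F) (e' : N → G) (f : M → N) : Prop :=
  IsSmoothMap e e' f ∧
    ∃ g : N → M, Function.LeftInverse g f ∧ Function.RightInverse g f ∧ IsSmoothMap e' e g

end Smooth

/-- The entries of a matrix, as a point of a normed space. -/
def entries {k : ℕ} {T : Set (Matrix (Fin k) (Fin k) ℝ)} (A : T) : Fin k → Fin k → ℝ :=
  fun i j => A.1 i j

/-- The smooth coordinates of a configuration, for spaces of configurations of distinct points:
the positions of the points. -/
def positions {n k : ℕ} {X : Set (Amb n k)} (x : X) : Fin n → E k := pos x.1

/-- The assertions on the pose map `Y ∩ C_{k+1}[S^{k-1}] → T` for a part `Y` of `Sim(Δ)`. -/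
structure PoseResult {k : ℕ} (Δ : Conf (k + 1) k) (Y : Set (Amb (k + 1) k))
    (T : Set (Matrix (Fin k) (Fin k) ℝ)) (h : Set.MapsTo (pose Δ) Y T) : Prop where
  /-- The intersection lies in the open configuration space `C_{k+1}(ℝ^k)`, where the positions
  of the points are smooth coordinates. -/
  subset_interior : Y ∩ sphereConf k ⊆ Set.range alpha
  /-- The intersection is a smooth submanifold of dimension `k(k-1)/2`. -/
  source_manifold : IsSmoothSubmanifold (k * (k - 1) / 2)
    (positions : (Y ∩ sphereConf k : Set (Amb (k + 1) k)) → Fin (k + 1) → E k)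
  /-- The target is a smooth submanifold of the space of matrices, of the same dimension. -/
  target_manifold : IsSmoothSubmanifold (k * (k - 1) / 2) (entries : T → Fin k → Fin k → ℝ)
  /-- The pose map is a diffeomorphism. -/
  diffeo : IsDiffeo positions entries
    (poseMap Δ (h.mono_left (Set.inter_subset_left (t := sphereConf k))))
  /-- The pose map induces an isomorphism on integral homology. -/
  homology_iso : ∀ n, IsIso (Hmap n
    (poseMap Δ (h.mono_left (Set.inter_subset_left (t := sphereConf k)))))
  /-- The inclusion of the intersection in `Y` induces an isomorphism on integral homology. -/
  incl_iso : ∀ n, IsIso (Hmap n (incl Y))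
  /-- The top classes of the intersection, taken in `Y`, correspond to the top classes of `T`. -/
  top_class : ∀ c : H (k * (k - 1) / 2) (Y ∩ sphereConf k : Set (Amb (k + 1) k)),
    IsTopClass _ _ c ↔
      IsTopClass _ _ ((Hmap _ (poseMap Δ h)).hom ((Hmap _ (incl Y)).hom c))

end InscribedSimplex

end

noncomputable section

namespace InscribedSimplex

/-! ### Homology of homotopic and homeomorphic spaces -/

section Homology

variable {X Y Z : Type} [TopologicalSpace X] [TopologicalSpace Y] [TopologicalSpace Z]

/-! A point of Sim(Δ) is determined by its first vertex a, a scale s ≥ 0 and an orthogonal matrix U: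
its vertices are a + sU(Δᵢ − Δ₀), its directions are those of Δ turned by U, and its ratios are
those of Δ (`eq_model_of_mem_sim`). The parameters depend continuously on the point, U differs from
the pose only by a constant right factor, and (a, s) ranges over the convex set ℝ^k × [0,∞).

For each U exactly one pair (a, s) gives an inscribed simplex (`eq_inscribed`). The limiting chord
directions at points of C_{k+1}[S^{k-1}] give the linear system of the circumcenter, and ‖a‖ = 1
forces s = 1/R, with R the circumradius of Δ. Hence s > 0, and no collapsed configuration is
inscribed. The pose is therefore a homeomorphism on inscribed simplices (`poseHomeomorph`), and
straight-line homotopies in (a, s) make their inclusion a homotopy equivalence (`isIso_Hmap_incl`).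

For smoothness, O(k) gets charts from the Cayley transform (`isSmoothSubmanifold_entries`). The pose
and its inverse are restrictions of linear maps between matrices and vertex tuples, which transport
these charts. Top classes match because the pose composed with the inclusion is a homeomorphism, and
homeomorphisms of pairs preserve local homology (`isTopClass_homeomorph_iff`). -/

theorem Hmap_comp (n : ℕ) (f : C(X, Y)) (g : C(Y, Z)) :
    Hmap n (g.comp f) = Hmap n f ≫ Hmap n g :=
  ((singularHomologyFunctor (ModuleCat.{0} ℤ) n).obj (ModuleCat.of ℤ ℤ)).map_comp
    (TopCat.ofHom f) (TopCat.ofHom g)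

theorem Hmap_id (n : ℕ) : Hmap n (ContinuousMap.id X) = 𝟙 (H n X) :=
  ((singularHomologyFunctor (ModuleCat.{0} ℤ) n).obj (ModuleCat.of ℤ ℤ)).map_id (TopCat.of X)

theorem Hmap_eq_of_homotopic (n : ℕ) {f g : C(X, Y)} (h : f.Homotopic g) :
    Hmap n f = Hmap n g := by
  obtain ⟨F⟩ := h
  have F' : TopCat.Homotopy (TopCat.ofHom f) (TopCat.ofHom g) := F
  exact F'.congr_homologyMap_singularChainComplexFunctor (ModuleCat.of ℤ ℤ) n

/-- A homotopy equivalence induces isomorphisms on homology. -/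
theorem isIso_Hmap_of_homotopic (n : ℕ) {f : C(X, Y)} {g : C(Y, X)}
    (hgf : (g.comp f).Homotopic (ContinuousMap.id X))
    (hfg : (f.comp g).Homotopic (ContinuousMap.id Y)) : IsIso (Hmap n f) :=
  ⟨Hmap n g, by rw [← Hmap_comp, Hmap_eq_of_homotopic n hgf, Hmap_id],
    by rw [← Hmap_comp, Hmap_eq_of_homotopic n hfg, Hmap_id]⟩

theorem isIso_Hmap_homeomorph (n : ℕ) (e : X ≃ₜ Y) : IsIso (Hmap n (e : C(X, Y))) := by
  refine isIso_Hmap_of_homotopic n (g := (e.symm : C(Y, X))) ?_ ?_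
  · rw [Homeomorph.symm_comp_toContinuousMap]
  · rw [Homeomorph.toContinuousMap_comp_symm]

/-- The map of pairs `(X, A) → (Y, B)` on relative chains. -/
def relChainsMap (f : C(X, Y)) {A : Set X} {B : Set Y} (h : Set.MapsTo f A B) :
    relChains X A ⟶ relChains Y B :=
  cokernel.map _ _ (chainsMap ⟨h.restrict, f.continuous.continuousOn.mapsToRestrict h⟩)
    (chainsMap f) (by
      rw [← Functor.map_comp, ← Functor.map_comp]
      rfl)

/-- The projection of the singular chains of `X` onto the relative chains of `(X, A)`. -/
def relChainsProj (X : Type) [TopologicalSpace X] (A : Set X) : chains X ⟶ relChains X A :=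
  cokernel.π (chainsMap (⟨Subtype.val, continuous_subtype_val⟩ : C(A, X)))

instance (A : Set X) : Epi (relChainsProj X A) :=
  inferInstanceAs (Epi (cokernel.π (chainsMap (⟨Subtype.val, continuous_subtype_val⟩ : C(A, X)))))

theorem relChainsProj_naturality (f : C(X, Y)) {A : Set X} {B : Set Y} (h : Set.MapsTo f A B) :
    relChainsProj X A ≫ relChainsMap f h = chainsMap f ≫ relChainsProj Y B :=
  cokernel.π_desc _ _ _

theorem toRel_naturality (n : ℕ) (f : C(X, Y)) {A : Set X} {B : Set Y} (h : Set.MapsTo f A B) :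
    toRel n X A ≫ HomologicalComplex.homologyMap (relChainsMap f h) n =
      Hmap n f ≫ toRel n Y B := by
  have h2 := congrArg (HomologicalComplex.homologyMap · n)
    (relChainsProj_naturality f h)
  rw [HomologicalComplex.homologyMap_comp, HomologicalComplex.homologyMap_comp] at h2
  exact h2

theorem relChainsMap_comp_symm (e : X ≃ₜ Y) {A : Set X} {B : Set Y}
    (h : Set.MapsTo (e : C(X, Y)) A B) (h' : Set.MapsTo (e.symm : C(Y, X)) B A) :
    relChainsMap (e : C(X, Y)) h ≫ relChainsMap (e.symm : C(Y, X)) h' = 𝟙 (relChains X A) := by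
  have he : TopCat.ofHom (e : C(X, Y)) ≫ TopCat.ofHom (e.symm : C(Y, X)) = 𝟙 (TopCat.of X) := by
    ext x
    exact e.symm_apply_apply x
  rw [← cancel_epi (relChainsProj X A), ← Category.assoc, relChainsProj_naturality,
    Category.assoc, relChainsProj_naturality, ← Category.assoc, ← Functor.map_comp, he,
    CategoryTheory.Functor.map_id, Category.id_comp, Category.comp_id]

/-- A homeomorphism of pairs induces an isomorphism on relative homology. -/
theorem isIso_relChainsMap (e : X ≃ₜ Y) {A : Set X} {B : Set Y}
    (h : Set.MapsTo (e : C(X, Y)) A B) (h' : Set.MapsTo (e.symm : C(Y, X)) B A) :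
    IsIso (relChainsMap (e : C(X, Y)) h) :=
  ⟨relChainsMap (e.symm : C(Y, X)) h', relChainsMap_comp_symm e h h',
    relChainsMap_comp_symm e.symm h' h⟩

theorem span_singleton_eq_top_iff_of_equiv {R M N : Type*} [Ring R] [AddCommGroup M]
    [AddCommGroup N] [Module R M] [Module R N] (L : M ≃ₗ[R] N) (m : M) :
    Submodule.span R {m} = ⊤ ↔ Submodule.span R {L m} = ⊤ := by
  have h : Submodule.span R {L m} = (Submodule.span R {m}).map (L : M →ₗ[R] N) := by
    rw [Submodule.map_span, Set.image_singleton]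
    rfl
  rw [h, Submodule.map_eq_top_iff]

/-- Top classes correspond under a homeomorphism. -/
theorem isTopClass_homeomorph_iff (d : ℕ) (e : X ≃ₜ Y) (c : H d X) :
    IsTopClass d X c ↔ IsTopClass d Y ((Hmap d (e : C(X, Y))).hom c) := by
  have key : ∀ x : X, Submodule.span ℤ {(toRel d X {x}ᶜ).hom c} = ⊤ ↔
      Submodule.span ℤ {(toRel d Y {e x}ᶜ).hom ((Hmap d (e : C(X, Y))).hom c)} = ⊤ := by
    intro x
    have h : Set.MapsTo (e : C(X, Y)) {x}ᶜ {e x}ᶜ := fun y hy h => hy (e.injective h)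
    have h' : Set.MapsTo (e.symm : C(Y, X)) {e x}ᶜ {x}ᶜ := fun y hy h =>
      hy (by rw [← Set.mem_singleton_iff.1 h]; exact (e.apply_symm_apply y).symm)
    have := isIso_relChainsMap e h h'
    have hn := congrArg (fun φ => φ.hom c) (toRel_naturality d (e : C(X, Y)) h)
    simp only [ModuleCat.hom_comp, LinearMap.comp_apply] at hn
    let L := (asIso (HomologicalComplex.homologyMap (relChainsMap (e : C(X, Y)) h) d)).toLinearEquiv
    have hL : L ((toRel d X {x}ᶜ).hom c) =
        (toRel d Y {e x}ᶜ).hom ((Hmap d (e : C(X, Y))).hom c) := hn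
    rw [← hL]
    exact span_singleton_eq_top_iff_of_equiv L _
  constructor
  · intro hc y
    obtain ⟨x, rfl⟩ := e.surjective y
    exact (key x).1 (hc x)
  · exact fun hc x => (key x).2 (hc (e x))

end Homology

/-! ### Smooth matrix-valued functions -/

section SmoothMatrix

variable {F : Type*} [NormedAddCommGroup F] [NormedSpace ℝ F] {k : ℕ} {U : Set F}
  {M N : F → Matrix (Fin k) (Fin k) ℝ}

theorem contDiffOn_matrix_mul (hM : ∀ i j, ContDiffOn ℝ ∞ (fun x => M x i j) U)
    (hN : ∀ i j, ContDiffOn ℝ ∞ (fun x => N x i j) U) (i j : Fin k) :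
    ContDiffOn ℝ ∞ (fun x => (M x * N x) i j) U := by
  simp only [Matrix.mul_apply]
  exact ContDiffOn.sum fun l _ => (hM i l).mul (hN l j)

theorem contDiffOn_matrix_det (hM : ∀ i j, ContDiffOn ℝ ∞ (fun x => M x i j) U) :
    ContDiffOn ℝ ∞ (fun x => (M x).det) U := by
  simp only [Matrix.det_apply']
  exact ContDiffOn.sum fun σ _ => contDiffOn_const.mul (contDiffOn_prod fun l _ => hM _ _)

/-- Cramer's rule: an entry of the inverse is the determinant of the matrix with one row replaced by
a constant one, divided by the full determinant. -/
theorem contDiffOn_matrix_inv (hM : ∀ i j, ContDiffOn ℝ ∞ (fun x => M x i j) U)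
    (h0 : ∀ x ∈ U, (M x).det ≠ 0) (i j : Fin k) :
    ContDiffOn ℝ ∞ (fun x => (M x)⁻¹ i j) U := by
  simp only [Matrix.inv_def, Matrix.smul_apply, Ring.inverse_eq_inv', smul_eq_mul,
    Matrix.adjugate_apply]
  refine ((contDiffOn_matrix_det hM).inv h0).mul (contDiffOn_matrix_det fun a b => ?_)
  by_cases h : a = j
  · subst h
    simpa using contDiffOn_const
  · simpa [Matrix.updateRow_ne h] using hM a b

end SmoothMatrix

/-! ### The Cayley transform -/

section Cayley

variable {k : ℕ}

/-- The Cayley transform `(1 - S)(1 + S)⁻¹`. -/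
def cayley (S : Matrix (Fin k) (Fin k) ℝ) : Matrix (Fin k) (Fin k) ℝ := (1 - S) * (1 + S)⁻¹

theorem contDiffOn_cayley {F : Type*} [NormedAddCommGroup F] [NormedSpace ℝ F] {U : Set F}
    {M : F → Matrix (Fin k) (Fin k) ℝ} (hM : ∀ i j, ContDiffOn ℝ ∞ (fun x => M x i j) U)
    (h0 : ∀ x ∈ U, (1 + M x).det ≠ 0) (i j : Fin k) :
    ContDiffOn ℝ ∞ (fun x => cayley (M x) i j) U :=
  contDiffOn_matrix_mul (fun a b => contDiffOn_const.sub (hM a b))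
    (contDiffOn_matrix_inv (fun a b => contDiffOn_const.add (hM a b)) h0) i j

/-- Skewness gives v · Sv = 0, so pairing (1 + S)v = 0 with v yields v · v = 0. -/
theorem det_one_add_ne_zero_of_skew {S : Matrix (Fin k) (Fin k) ℝ} (hS : S.transpose = -S) :
    (1 + S).det ≠ 0 := by
  intro h
  obtain ⟨v, hv, h0⟩ := Matrix.exists_mulVec_eq_zero_iff.2 h
  rw [Matrix.add_mulVec, Matrix.one_mulVec] at h0
  have h1 : v ⬝ᵥ S.mulVec v = 0 := by
    have h2 : v ⬝ᵥ S.mulVec v = -(v ⬝ᵥ S.mulVec v) := by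
      conv_lhs => rw [Matrix.dotProduct_mulVec, ← Matrix.mulVec_transpose, hS,
        Matrix.neg_mulVec, neg_dotProduct, dotProduct_comm]
    linarith
  have h3 := congrArg (v ⬝ᵥ ·) h0
  simp only [dotProduct_add, h1, add_zero, dotProduct_zero] at h3
  exact hv (dotProduct_self_eq_zero.1 h3)

theorem one_add_cayley {B : Matrix (Fin k) (Fin k) ℝ} (hB : (1 + B).det ≠ 0) :
    1 + cayley B = (2 : ℝ) • (1 + B)⁻¹ := by
  have h : (1 + B) * (1 + B)⁻¹ = 1 := Matrix.mul_nonsing_inv _ (isUnit_iff_ne_zero.2 hB)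
  calc 1 + cayley B = (1 + B) * (1 + B)⁻¹ + (1 - B) * (1 + B)⁻¹ := by rw [h, cayley]
    _ = (2 : ℝ) • (1 + B)⁻¹ := by
      rw [← add_mul, add_add_sub_cancel, add_mul, one_mul, two_smul]

theorem one_sub_cayley {B : Matrix (Fin k) (Fin k) ℝ} (hB : (1 + B).det ≠ 0) :
    1 - cayley B = (2 : ℝ) • (B * (1 + B)⁻¹) := by
  have h : (1 + B) * (1 + B)⁻¹ = 1 := Matrix.mul_nonsing_inv _ (isUnit_iff_ne_zero.2 hB)
  calc 1 - cayley B = (1 + B) * (1 + B)⁻¹ - (1 - B) * (1 + B)⁻¹ := by rw [h, cayley]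
    _ = (2 : ℝ) • (B * (1 + B)⁻¹) := by
      rw [← sub_mul, add_sub_sub_cancel, add_mul, two_smul]

theorem det_one_add_cayley_ne_zero {B : Matrix (Fin k) (Fin k) ℝ} (hB : (1 + B).det ≠ 0) :
    (1 + cayley B).det ≠ 0 := by
  rw [one_add_cayley hB, Matrix.det_smul, Matrix.det_nonsing_inv]
  simpa using hB

/-- The factors 1 − C and 1 + C for C = `cayley B` are 2B(1 + B)⁻¹ and 2(1 + B)⁻¹, whose quotient is
B. Only invertibility of 1 + B is needed, so this serves both skew and orthogonal B. -/
theorem cayley_cayley {B : Matrix (Fin k) (Fin k) ℝ} (hB : (1 + B).det ≠ 0) :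
    cayley (cayley B) = B := by
  have h1 := Matrix.mul_nonsing_inv _ (isUnit_iff_ne_zero.2 (det_one_add_cayley_ne_zero hB))
  have h : B * (1 + cayley B) = 1 - cayley B := by
    rw [one_add_cayley hB, one_sub_cayley hB, Matrix.mul_smul]
  rw [cayley, ← h, Matrix.mul_assoc, h1, Matrix.mul_one]

theorem cayley_transpose_of_orthogonal {B : Matrix (Fin k) (Fin k) ℝ}
    (hO : B.transpose * B = 1) (hB : (1 + B).det ≠ 0) : (cayley B).transpose = -cayley B := by
  have hB' : IsUnit (1 + B).det := isUnit_iff_ne_zero.2 hB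
  have hBt : IsUnit (1 + B).transpose.det := by rwa [Matrix.det_transpose]
  -- By orthogonality both sides equal B − Bᵀ.
  have key : (1 - B).transpose * (1 + B) = -((1 + B).transpose * (1 - B)) := by
    simp only [Matrix.transpose_add, Matrix.transpose_sub, Matrix.transpose_one, sub_mul, add_mul,
      mul_add, mul_sub, hO, one_mul, mul_one]
    abel
  rw [cayley, Matrix.transpose_mul, Matrix.transpose_nonsing_inv]
  calc ((1 + B).transpose)⁻¹ * (1 - B).transpose
      = ((1 + B).transpose)⁻¹ * ((1 - B).transpose * (1 + B)) * (1 + B)⁻¹ := by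
        rw [← mul_assoc, mul_assoc _ (1 + B), Matrix.mul_nonsing_inv _ hB', mul_one]
    _ = -((1 - B) * (1 + B)⁻¹) := by
        rw [key, mul_neg, neg_mul, ← mul_assoc, Matrix.nonsing_inv_mul _ hBt, one_mul]

theorem one_add_transpose_of_skew {S : Matrix (Fin k) (Fin k) ℝ} (hS : S.transpose = -S) :
    (1 + S).transpose = 1 - S := by
  rw [Matrix.transpose_add, hS, Matrix.transpose_one, sub_eq_add_neg]

/-- Since 1 − S = (1 + S)ᵀ, the two determinants cancel. This keeps the Cayley charts inside one
determinant class. -/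
theorem det_cayley_of_skew {S : Matrix (Fin k) (Fin k) ℝ} (hS : S.transpose = -S) :
    (cayley S).det = 1 := by
  rw [cayley, ← one_add_transpose_of_skew hS, Matrix.det_mul, Matrix.det_transpose,
    ← Matrix.det_mul, Matrix.mul_nonsing_inv _ (isUnit_iff_ne_zero.2
      (det_one_add_ne_zero_of_skew hS)), Matrix.det_one]

theorem cayley_mem_orthogonalGroup {S : Matrix (Fin k) (Fin k) ℝ} (hS : S.transpose = -S) :
    cayley S ∈ Matrix.orthogonalGroup (Fin k) ℝ := by
  have hu : IsUnit (1 + S).det := isUnit_iff_ne_zero.2 (det_one_add_ne_zero_of_skew hS)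
  have ht : (1 - S).transpose = 1 + S := by
    rw [← one_add_transpose_of_skew hS, Matrix.transpose_transpose]
  have hu' : IsUnit (1 - S).det := by
    rwa [← one_add_transpose_of_skew hS, Matrix.det_transpose]
  rw [Matrix.mem_orthogonalGroup_iff']
  change (cayley S).transpose * cayley S = 1
  have hc : (1 + S) * (1 - S) = (1 - S) * (1 + S) := by noncomm_ring
  rw [cayley, Matrix.transpose_mul, Matrix.transpose_nonsing_inv, one_add_transpose_of_skew hS,
    ht, mul_assoc, ← mul_assoc (1 + S), hc, mul_assoc (1 - S), Matrix.mul_nonsing_inv _ hu,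
    mul_one, Matrix.nonsing_inv_mul _ hu']

end Cayley

/-! ### Skew-symmetric matrices -/

section Skew

variable {k d : ℕ}

theorem card_strictUpper (k : ℕ) : Fintype.card (Σ j : Fin k, Fin j) = k * (k - 1) / 2 := by
  rw [Fintype.card_sigma]
  simp only [Fintype.card_fin]
  rw [Fin.sum_univ_eq_sum_range (fun i => i), Finset.sum_range_id]

/-- The skew-symmetric matrix with prescribed entries above the diagonal. -/
def skew (e : (Σ j : Fin k, Fin j) ≃ Fin d) (v : Fin d → ℝ) : Matrix (Fin k) (Fin k) ℝ :=
  Matrix.of fun i j =>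
    if h : i < j then v (e ⟨j, i, h⟩) else if h : j < i then -v (e ⟨i, j, h⟩) else 0

/-- The entries of a matrix above the diagonal. -/
def upper (e : (Σ j : Fin k, Fin j) ≃ Fin d) (S : Matrix (Fin k) (Fin k) ℝ) : Fin d → ℝ :=
  (fun x : Σ j : Fin k, Fin j => S ⟨x.2, x.2.2.trans x.1.2⟩ x.1) ∘ e.symm

theorem upper_apply (e : (Σ j : Fin k, Fin j) ≃ Fin d) (S : Matrix (Fin k) (Fin k) ℝ)
    (x : Σ j : Fin k, Fin j) : upper e S (e x) = S ⟨x.2, x.2.2.trans x.1.2⟩ x.1 := by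
  rw [upper, Function.comp_apply, e.symm_apply_apply]

theorem skew_transpose (e : (Σ j : Fin k, Fin j) ≃ Fin d) (v : Fin d → ℝ) :
    (skew e v).transpose = -skew e v := by
  ext i j
  rcases lt_trichotomy i j with h | h | h
  · simp [skew, h, h.not_gt]
  · simp [skew, h]
  · simp [skew, h, h.not_gt]

theorem upper_skew (e : (Σ j : Fin k, Fin j) ≃ Fin d) (v : Fin d → ℝ) :
    upper e (skew e v) = v := by
  ext l
  obtain ⟨⟨j, i⟩, rfl⟩ := e.surjective l
  have h : (⟨i, i.2.trans j.2⟩ : Fin k) < j := i.2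
  simp [upper_apply, skew, h]

theorem skew_upper (e : (Σ j : Fin k, Fin j) ≃ Fin d) {S : Matrix (Fin k) (Fin k) ℝ}
    (hS : S.transpose = -S) : skew e (upper e S) = S := by
  have hS' : ∀ i j, S j i = -S i j := fun i j => congrFun (congrFun hS i) j
  ext i j
  rcases lt_trichotomy i j with h | h | h
  · simp [upper_apply, skew, h]
  · subst h
    have := hS' i i
    simp only [skew, lt_irrefl, Matrix.of_apply, dite_false]
    linarith
  · simp [upper_apply, skew, h, h.not_gt, hS' j i]

theorem contDiff_skew_apply (e : (Σ j : Fin k, Fin j) ≃ Fin d) (i j : Fin k) :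
    ContDiff ℝ ∞ fun v : E d => skew e v i j := by
  by_cases h : i < j
  · simp only [skew, h, Matrix.of_apply, dite_true]
    fun_prop
  · by_cases h' : j < i
    · simp only [skew, h, h', Matrix.of_apply, dite_true, dite_false]
      fun_prop
    · simp only [skew, h, h', Matrix.of_apply, dite_false]
      fun_prop

end Skew

/-! ### Submanifolds of the orthogonal group -/

section Submanifold

theorem isEmbedding_entries {k : ℕ} (T : Set (Matrix (Fin k) (Fin k) ℝ)) :
    IsEmbedding (entries : T → Fin k → Fin k → ℝ) :=
  IsEmbedding.subtypeVal

/-- A union of components of the orthogonal group is a submanifold: the Cayley transform gives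
charts. -/
theorem isSmoothSubmanifold_entries {k : ℕ} {T : Set (Matrix (Fin k) (Fin k) ℝ)} (hT : T ⊆ O k)
    (hdet : ∀ A ∈ T, ∀ B ∈ O k, B.det = A.det → B ∈ T) :
    IsSmoothSubmanifold (k * (k - 1) / 2) (entries : T → Fin k → Fin k → ℝ) := by
  refine ⟨isEmbedding_entries T, fun ⟨A, hA⟩ => ?_⟩
  have hAO : A.transpose * A = 1 := Matrix.mem_orthogonalGroup_iff' _ _ |>.1 (hT hA)
  have hAO' : A * A.transpose = 1 := Matrix.mem_orthogonalGroup_iff _ _ |>.1 (hT hA)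
  let e : (Σ j : Fin k, Fin j) ≃ Fin (k * (k - 1) / 2) :=
    Fintype.equivFinOfCardEq (card_strictUpper k)
  let ρ : (Fin k → Fin k → ℝ) → Matrix (Fin k) (Fin k) ℝ := fun M => A.transpose * Matrix.of M
  have hρ : ∀ (U : Set (Fin k → Fin k → ℝ)) i j, ContDiffOn ℝ ∞ (fun M => ρ M i j) U :=
    fun U => contDiffOn_matrix_mul (fun _ _ => contDiffOn_const) fun a b => by
      simp only [Matrix.of_apply]
      fun_prop
  have hdc : ContinuousOn (fun M => (1 + ρ M).det) Set.univ :=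
    (contDiffOn_matrix_det fun i j => contDiffOn_const.add (hρ _ i j)).continuousOn
  -- The chart at A is the Cayley chart at the identity translated by A. It is defined where 1 + AᵀM
  -- is invertible, and its parameter space is all of ℝ^d.
  refine ⟨{M | (1 + ρ M).det ≠ 0}, isOpen_ne_fun (continuousOn_univ.1 hdc) continuous_const,
    ?_, Set.univ, isOpen_univ, fun v i j => (A * cayley (skew e v)) i j,
    fun M => WithLp.toLp 2 (upper e (cayley (ρ M))), ?_, ?_, ?_, ?_⟩
  · change (1 + A.transpose * A).det ≠ 0
    rw [hAO, one_add_one_eq_two, ← Nat.cast_ofNat, ← Matrix.diagonal_natCast,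
      Matrix.det_diagonal]
    simp
  · refine contDiffOn_pi.2 fun i => contDiffOn_pi.2 fun j => ?_
    exact contDiffOn_matrix_mul (M := fun _ => A) (fun _ _ => contDiffOn_const) (contDiffOn_cayley
      (fun a b => (contDiff_skew_apply e a b).contDiffOn)
      fun v _ => det_one_add_ne_zero_of_skew (skew_transpose e v)) i j
  · refine contDiffOn_piLp' 2 fun l => ?_
    exact contDiffOn_cayley (hρ _) (fun M hM => hM) _ _
  · ext M
    constructor
    · rintro ⟨v, -, rfl⟩
      have hs := skew_transpose e v
      have hmem : A * cayley (skew e v) ∈ T := hdet A hA _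
        (Submonoid.mul_mem (Matrix.orthogonalGroup (Fin k) ℝ) (hT hA) (cayley_mem_orthogonalGroup hs))
        (by rw [Matrix.det_mul, det_cayley_of_skew hs, mul_one])
      refine ⟨⟨⟨_, hmem⟩, rfl⟩, ?_⟩
      change (1 + A.transpose * (A * cayley (skew e v))).det ≠ 0
      rw [← mul_assoc, hAO, one_mul]
      exact det_one_add_cayley_ne_zero (det_one_add_ne_zero_of_skew hs)
    · rintro ⟨⟨⟨B, hB⟩, rfl⟩, hU⟩
      have hU' : (1 + A.transpose * B).det ≠ 0 := hU
      have hBO : B.transpose * B = 1 := Matrix.mem_orthogonalGroup_iff' _ _ |>.1 (hT hB)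
      have hO : (A.transpose * B).transpose * (A.transpose * B) = 1 := by
        rw [Matrix.transpose_mul, Matrix.transpose_transpose, mul_assoc, ← mul_assoc A, hAO',
          one_mul, hBO]
      refine ⟨WithLp.toLp 2 (upper e (cayley (A.transpose * B))), trivial, ?_⟩
      ext i j
      change (A * cayley (skew e (upper e (cayley (A.transpose * B))))) i j = B i j
      rw [skew_upper e (cayley_transpose_of_orthogonal hO hU'), cayley_cayley hU', ← mul_assoc,
        hAO', one_mul]
  · intro v _
    change WithLp.toLp 2 (upper e (cayley (A.transpose * (A * cayley (skew e v))))) = v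
    rw [← mul_assoc, hAO, one_mul,
      cayley_cayley (det_one_add_ne_zero_of_skew (skew_transpose e v)), upper_skew]

variable {M N F G : Type} [TopologicalSpace M] [TopologicalSpace N] [NormedAddCommGroup F]
  [NormedSpace ℝ F] [NormedAddCommGroup G] [NormedSpace ℝ G]

/-- A homeomorphism which is the restriction of a smooth map of the ambient spaces, as is its
inverse, carries the submanifold structure of its target to its source. -/
theorem IsSmoothSubmanifold.of_homeomorph {d : ℕ} {e : N → G} (he : IsSmoothSubmanifold d e)
    (h : M ≃ₜ N) {e' : M → F} {L : G → F} {K : F → G} (hL : ContDiff ℝ ∞ L)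
    (hK : ContDiff ℝ ∞ K) (hLe : ∀ x, e' x = L (e (h x))) (hKe : ∀ x, K (e' x) = e (h x)) :
    IsSmoothSubmanifold d e' := by
  have hcont : Continuous e' := by
    have : e' = L ∘ e ∘ h := funext hLe
    rw [this]
    exact hL.continuous.comp (he.1.continuous.comp h.continuous)
  have hemb : IsEmbedding (K ∘ e') := by
    have : K ∘ e' = e ∘ h := funext hKe
    rw [this]
    exact he.1.comp h.isEmbedding
  refine ⟨IsEmbedding.of_comp hcont hK.continuous hemb, fun x => ?_⟩
  obtain ⟨U, hU, hxU, V, hV, ψ, φ, hψ, hφ, himg, hinv⟩ := he.2 (h x)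
  -- K inverts L only on the image of e; this suffices because ψ maps V into that image.
  have hKL : ∀ n, K (L (e n)) = e n := fun n => by
    obtain ⟨m, rfl⟩ := h.surjective n
    rw [← hLe, hKe]
  have hKLψ : ∀ v ∈ V, K (L (ψ v)) = ψ v := fun v hv => by
    obtain ⟨⟨n, hn⟩, -⟩ : ψ v ∈ Set.range e ∩ U := himg ▸ ⟨v, hv, rfl⟩
    rw [← hn, hKL]
  refine ⟨K ⁻¹' U, hU.preimage hK.continuous, by rwa [Set.mem_preimage, hKe], V, hV, L ∘ ψ, φ ∘ K,
    hL.comp_contDiffOn hψ, hφ.comp hK.contDiffOn fun _ hx => hx, ?_, fun v hv => ?_⟩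
  · rw [Set.image_comp, himg]
    ext y
    constructor
    · rintro ⟨_, ⟨⟨n, rfl⟩, hn⟩, rfl⟩
      refine ⟨⟨h.symm n, by rw [hLe, h.apply_symm_apply]⟩, ?_⟩
      rwa [Set.mem_preimage, hKL]
    · rintro ⟨⟨m, rfl⟩, hm⟩
      rw [Set.mem_preimage, hKe] at hm
      exact ⟨_, ⟨⟨h m, rfl⟩, hm⟩, (hLe m).symm⟩
  · change φ (K (L (ψ v))) = v
    rw [hKLψ v hv, hinv v hv]

theorem isDiffeo_of_homeomorph {e : N → G} (h : M ≃ₜ N) {e' : M → F} {L : G → F} {K : F → G}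
    (hL : ContDiff ℝ ∞ L) (hK : ContDiff ℝ ∞ K) (hLe : ∀ x, e' x = L (e (h x)))
    (hKe : ∀ x, K (e' x) = e (h x)) : IsDiffeo e' e h :=
  ⟨fun _ => ⟨Set.univ, isOpen_univ, trivial, K, hK.contDiffOn, fun y _ => (hKe y).symm⟩,
    h.symm, h.symm_apply_apply, h.apply_symm_apply, fun _ => ⟨Set.univ, isOpen_univ, trivial, L,
      hL.contDiffOn, fun y _ => by rw [hLe, h.apply_symm_apply]⟩⟩

end Submanifold

/-! ### The similar simplices as a family `a + s U (Δ - Δ₀)` -/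

section Model

variable {k : ℕ}

theorem transpose_mul_of_mem_O {U : Matrix (Fin k) (Fin k) ℝ} (hU : U ∈ O k) :
    U.transpose * U = 1 :=
  (Matrix.mem_orthogonalGroup_iff' _ _).1 hU

theorem mul_transpose_of_mem_O {U : Matrix (Fin k) (Fin k) ℝ} (hU : U ∈ O k) :
    U * U.transpose = 1 :=
  (Matrix.mem_orthogonalGroup_iff _ _).1 hU

theorem transpose_mem_O {U : Matrix (Fin k) (Fin k) ℝ} (hU : U ∈ O k) : U.transpose ∈ O k := by
  refine (Matrix.mem_orthogonalGroup_iff _ _).2 ?_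
  rw [Matrix.transpose_transpose, transpose_mul_of_mem_O hU]

theorem mul_mem_O {U W : Matrix (Fin k) (Fin k) ℝ} (hU : U ∈ O k) (hW : W ∈ O k) : U * W ∈ O k :=
  Submonoid.mul_mem (Matrix.orthogonalGroup (Fin k) ℝ) hU hW

theorem toEuclideanLin_mul_apply (U W : Matrix (Fin k) (Fin k) ℝ) (x : E k) :
    (U * W).toEuclideanLin x = U.toEuclideanLin (W.toEuclideanLin x) := by
  simp [Matrix.toLpLin_apply, Matrix.mulVec_mulVec]

theorem inner_toEuclideanLin_left (U : Matrix (Fin k) (Fin k) ℝ) (x y : E k) :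
    inner ℝ (U.toEuclideanLin x) y = inner ℝ x (U.transpose.toEuclideanLin y) := by
  have h := Matrix.toEuclideanLin_conjTranspose_eq_adjoint U
  rw [Matrix.conjTranspose_eq_transpose_of_trivial] at h
  rw [h, LinearMap.adjoint_inner_right]

theorem inner_toEuclideanLin {U : Matrix (Fin k) (Fin k) ℝ} (hU : U ∈ O k) (x y : E k) :
    inner ℝ (U.toEuclideanLin x) (U.toEuclideanLin y) = inner ℝ x y := by
  rw [inner_toEuclideanLin_left, ← toEuclideanLin_mul_apply, transpose_mul_of_mem_O hU]
  simp

theorem norm_toEuclideanLin {U : Matrix (Fin k) (Fin k) ℝ} (hU : U ∈ O k) (x : E k) :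
    ‖U.toEuclideanLin x‖ = ‖x‖ := by
  rw [← sq_eq_sq₀ (norm_nonneg _) (norm_nonneg _), ← real_inner_self_eq_norm_sq,
    ← real_inner_self_eq_norm_sq, inner_toEuclideanLin hU]

theorem continuous_toEuclideanLin (v : E k) :
    Continuous fun M : Matrix (Fin k) (Fin k) ℝ => M.toEuclideanLin v := by
  simp only [Matrix.toLpLin_apply]
  exact (PiLp.continuous_toLp 2 _).comp (continuous_id.matrix_mulVec continuous_const)

variable (Δ : Conf (k + 1) k)

/-- The point of `Sim(Δ)` with first vertex `a`, scale `s` and rotation `U`. -/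
def model (U : O k) (a : E k) (s : ℝ) : Amb (k + 1) k :=
  (fun i => a + s • U.1.toEuclideanLin (Δ.1 i - Δ.1 0),
    fun t => ⟨U.1.toEuclideanLin (dir Δ t : E k), by
      rw [mem_sphere_zero_iff_norm, norm_toEuclideanLin U.2, norm_eq_of_mem_sphere]⟩,
    ratio Δ)

theorem continuous_model :
    Continuous fun p : O k × E k × ℝ => model Δ p.1 p.2.1 p.2.2 := by
  have hU : Continuous fun p : O k × E k × ℝ => p.1.1 :=
    continuous_subtype_val.comp continuous_fst
  refine Continuous.prodMk (continuous_pi fun i => ?_) (Continuous.prodMk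
    (continuous_pi fun t => Continuous.subtype_mk ?_ _) continuous_const)
  · exact continuous_snd.fst.add (continuous_snd.snd.smul
      ((continuous_toEuclideanLin _).comp hU))
  · exact (continuous_toEuclideanLin _).comp hU

theorem Pi_model (U : O k) (a : E k) (s : ℝ) :
    Pi (model Δ U a s) = U.1 * Pi (alpha Δ) := by
  ext i j
  simp [Pi, model, alpha, Matrix.toLpLin_apply, Matrix.mul_apply, Matrix.mulVec, dotProduct]

theorem pose_model (U : O k) (a : E k) (s : ℝ) :
    pose Δ (model Δ U a s) = U.1 * pose Δ (alpha Δ) := by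
  rw [pose, Pi_model, pose, Matrix.mul_assoc]

/-- For `s > 0` the model is a simplex with distinct vertices. -/
theorem exists_alpha_eq_model (U : O k) (a : E k) {s : ℝ} (hs : 0 < s) :
    ∃ q : Conf (k + 1) k, alpha q = model Δ U a s := by
  have hsub : ∀ i j, (a + s • U.1.toEuclideanLin (Δ.1 i - Δ.1 0)) -
      (a + s • U.1.toEuclideanLin (Δ.1 j - Δ.1 0)) = s • U.1.toEuclideanLin (Δ.1 i - Δ.1 j) := by
    intro i j
    rw [add_sub_add_left_eq_sub, ← smul_sub, ← map_sub, sub_sub_sub_cancel_right]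
  have hnorm : ∀ i j, ‖s • U.1.toEuclideanLin (Δ.1 i - Δ.1 j)‖ = s * ‖Δ.1 i - Δ.1 j‖ := by
    intro i j
    rw [norm_smul, norm_toEuclideanLin U.2, Real.norm_of_nonneg hs.le]
  refine ⟨⟨(model Δ U a s).1, fun i j hij => ?_⟩, ?_⟩
  · have h := hnorm i j
    rw [(hsub i j).symm.trans (sub_eq_zero.2 hij), norm_zero, eq_comm, mul_eq_zero] at h
    exact Δ.2 (sub_eq_zero.1 (norm_eq_zero.1 (h.resolve_left hs.ne')))
  · refine Prod.ext rfl (Prod.ext (funext fun t => Subtype.ext ?_) (funext fun t => ?_))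
    · simp only [alpha, dir, model]
      rw [hsub, hnorm, map_smul, smul_smul, mul_inv_rev, mul_assoc, inv_mul_cancel₀ hs.ne',
        mul_one]
    · simp only [alpha, ratio, model]
      rw [hsub, hsub, hnorm, hnorm, mul_div_mul_left _ _ hs.ne']

/-- Directions and ratios of the model do not depend on s, so the collapsed point s = 0 is the limit
of nondegenerate simplices as s decreases to 0. -/
theorem model_mem_sim (U : O k) (a : E k) {s : ℝ} (hs : 0 ≤ s) : model Δ U a s ∈ sim Δ := by
  have hc : Continuous fun s => model Δ U a s :=
    (continuous_model Δ).comp (continuous_const.prodMk (continuous_const.prodMk continuous_id))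
  refine map_mem_closure hc (s := Set.Ioi 0) (by rwa [closure_Ioi]) fun r hr => ?_
  obtain ⟨q, hq⟩ := exists_alpha_eq_model Δ U a hr
  exact ⟨q, fun t => congrFun (congrArg (fun x => x.2.2) hq) t, hq⟩

/-- The rotation that carries `Δ` to the simplex `x` similar to it. -/
def frame (x : Amb (k + 1) k) : Matrix (Fin k) (Fin k) ℝ :=
  pose Δ x * (pose Δ (alpha Δ)).transpose

/-- The ratio between the sizes of the simplices `x` and `Δ`. -/
def scale (x : Amb (k + 1) k) : ℝ :=
  ‖pos x (Fin.last k) - pos x 0‖ / ‖Δ.1 (Fin.last k) - Δ.1 0‖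

theorem scale_nonneg (x : Amb (k + 1) k) : 0 ≤ scale Δ x := by
  unfold scale
  positivity

theorem continuous_frame : Continuous (frame Δ) :=
  (continuous_pose Δ).matrix_mul continuous_const

theorem continuous_pos (i : Fin (k + 1)) : Continuous fun x : Amb (k + 1) k => pos x i :=
  (continuous_apply i).comp continuous_fst

theorem continuous_scale : Continuous (scale Δ) :=
  ((continuous_pos _).sub (continuous_pos _)).norm.div_const _

theorem alpha_mem_sim : alpha Δ ∈ sim Δ := subset_closure ⟨Δ, fun _ => rfl, rfl⟩

variable {Δ}

theorem pose_alpha_mem_O (hΔ : AffineIndependent ℝ Δ.1) : pose Δ (alpha Δ) ∈ O k :=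
  mapsTo_pose Δ hΔ (alpha_mem_sim Δ)

theorem frame_mem_O (hΔ : AffineIndependent ℝ Δ.1) {x : Amb (k + 1) k} (hx : pose Δ x ∈ O k) :
    frame Δ x ∈ O k :=
  mul_mem_O hx (transpose_mem_O (pose_alpha_mem_O hΔ))

theorem frame_mul_pose_alpha (hΔ : AffineIndependent ℝ Δ.1) (x : Amb (k + 1) k) :
    frame Δ x * pose Δ (alpha Δ) = pose Δ x := by
  rw [frame, Matrix.mul_assoc, transpose_mul_of_mem_O (pose_alpha_mem_O hΔ), Matrix.mul_one]

/-- The polar decompositions of Π(x) and Π(Δ) share the factor P(Δ), so the matrix relating the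
poses also relates the direction matrices. -/
theorem frame_mul_Pi (hΔ : AffineIndependent ℝ Δ.1) (x : Amb (k + 1) k) :
    frame Δ x * Pi (alpha Δ) = Pi x := by
  rw [← pose_mul_P Δ hΔ (alpha Δ), ← Matrix.mul_assoc, frame_mul_pose_alpha hΔ,
    pose_mul_P Δ hΔ x]

theorem frame_dir (hΔ : AffineIndependent ℝ Δ.1) (x : Amb (k + 1) k) (j : Fin k) :
    (frame Δ x).toEuclideanLin (dir Δ ⟨(j.succ, 0), Fin.succ_ne_zero j⟩ : E k) =
      (x.2.1 ⟨(j.succ, 0), Fin.succ_ne_zero j⟩ : E k) := by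
  ext i
  have h := congrFun (congrFun (frame_mul_Pi hΔ x) i) j
  simp only [Pi, Matrix.mul_apply, Matrix.of_apply] at h
  rw [← h]
  rfl

theorem norm_smul_dir {n : ℕ} (q : Conf n k) (t : Pairs n) :
    ‖q.1 t.1.1 - q.1 t.1.2‖ • (dir q t : E k) = q.1 t.1.1 - q.1 t.1.2 := by
  have h : ‖q.1 t.1.1 - q.1 t.1.2‖ ≠ 0 :=
    norm_ne_zero_iff.2 (sub_ne_zero.2 fun h => t.2 (q.2 h))
  simp only [dir]
  rw [smul_smul, mul_inv_cancel₀ h, one_smul]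

theorem norm_sub_pos (q : Conf (k + 1) k) {i j : Fin (k + 1)} (h : i ≠ j) :
    0 < ‖q.1 i - q.1 j‖ :=
  norm_pos_iff.2 (sub_ne_zero.2 fun h' => h (q.2 h'))

theorem last_ne_zero (hk : 1 ≤ k) : Fin.last k ≠ 0 := by
  rw [Ne, Fin.ext_iff, Fin.val_last, Fin.val_zero]
  omega

theorem norm_sub_eq_scale (hk : 1 ≤ k) {q : Conf (k + 1) k} (hq : q ∈ simOpen Δ)
    (i : Fin (k + 1)) : ‖q.1 i - q.1 0‖ = scale Δ (alpha q) * ‖Δ.1 i - Δ.1 0‖ := by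
  have hl := last_ne_zero hk
  have hΔl := (norm_sub_pos Δ hl).ne'
  have hql := (norm_sub_pos q hl).ne'
  change _ = ‖q.1 (Fin.last k) - q.1 0‖ / ‖Δ.1 (Fin.last k) - Δ.1 0‖ * _
  by_cases h0 : i = 0
  · simp [h0]
  by_cases h1 : i = Fin.last k
  · rw [h1, div_mul_cancel₀ _ hΔl]
  -- The ratio at vertex 0 compares the edge to i with the edge to the last vertex, which defines
  -- the scale.
  · have h := congrArg ENNReal.toReal (hq ⟨(0, i, Fin.last k), Ne.symm h0, h1, hl.symm⟩)
    rw [ratio_toReal, ratio_toReal] at h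
    simp only [norm_sub_rev _ (q.1 i), norm_sub_rev _ (Δ.1 i), norm_sub_rev _ (q.1 (Fin.last k)),
      norm_sub_rev _ (Δ.1 (Fin.last k))] at h
    rw [div_eq_div_iff hql hΔl] at h
    rw [div_mul_eq_mul_div, eq_div_iff hΔl, h, mul_comm]

/-- All the coordinate identities are closed conditions on x, so it is enough to verify them on
nondegenerate simplices. There the edges from vertex 0 have known lengths (`norm_sub_eq_scale`) and
directions (`frame_dir`). -/
theorem eq_model_of_mem_sim (hk : 1 ≤ k) (hΔ : AffineIndependent ℝ Δ.1) {x : Amb (k + 1) k}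
    (hx : x ∈ sim Δ) :
    x = model Δ ⟨frame Δ x, frame_mem_O hΔ (mapsTo_pose Δ hΔ hx)⟩ (pos x 0) (scale Δ x) := by
  have hact : ∀ v : E k, Continuous fun x => (frame Δ x).toEuclideanLin v := fun v =>
    (continuous_toEuclideanLin v).comp (continuous_frame Δ)
  have hclosed : IsClosed {x : Amb (k + 1) k |
      (∀ i, pos x i = pos x 0 + scale Δ x • (frame Δ x).toEuclideanLin (Δ.1 i - Δ.1 0)) ∧
      (∀ t, (x.2.1 t : E k) = (frame Δ x).toEuclideanLin (dir Δ t : E k)) ∧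
      ∀ t, x.2.2 t = ratio Δ t} := by
    have h1 (i) : IsClosed {x : Amb (k + 1) k |
        pos x i = pos x 0 + scale Δ x • (frame Δ x).toEuclideanLin (Δ.1 i - Δ.1 0)} :=
      isClosed_eq (continuous_pos i) ((continuous_pos 0).add ((continuous_scale Δ).smul (hact _)))
    have h2 (t) : IsClosed {x : Amb (k + 1) k |
        (x.2.1 t : E k) = (frame Δ x).toEuclideanLin (dir Δ t : E k)} :=
      isClosed_eq (by fun_prop) (hact _)
    have h3 (t) : IsClosed {x : Amb (k + 1) k | x.2.2 t = ratio Δ t} :=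
      isClosed_eq (by fun_prop) continuous_const
    rw [Set.ofPred_and, Set.ofPred_and, Set.ofPred_forall, Set.ofPred_forall, Set.ofPred_forall]
    exact (isClosed_iInter h1).inter ((isClosed_iInter h2).inter (isClosed_iInter h3))
  have hmem := closure_minimal ?_ hclosed hx
  · obtain ⟨h1, h2, h3⟩ := hmem
    exact Prod.ext (funext h1) (Prod.ext (funext fun t => Subtype.ext (h2 t)) (funext h3))
  · rintro _ ⟨q, hq, rfl⟩
    have hpos : ∀ i, q.1 i =
        q.1 0 + scale Δ (alpha q) • (frame Δ (alpha q)).toEuclideanLin (Δ.1 i - Δ.1 0) := by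
      intro i
      refine Fin.cases ?_ (fun j => ?_) i
      · simp
      · rw [← sub_eq_iff_eq_add']
        have h1 := norm_smul_dir q ⟨(j.succ, 0), Fin.succ_ne_zero j⟩
        have h2 := norm_smul_dir Δ ⟨(j.succ, 0), Fin.succ_ne_zero j⟩
        simp only at h1 h2
        rw [← h1, ← h2, map_smul, frame_dir hΔ, smul_smul, norm_sub_eq_scale hk hq]
        rfl
    refine ⟨hpos, ?_, hq⟩
    have hs : 0 < scale Δ (alpha q) := by
      exact div_pos (norm_sub_pos q (last_ne_zero hk)) (norm_sub_pos Δ (last_ne_zero hk))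
    have hO : frame Δ (alpha q) ∈ O k :=
      frame_mem_O hΔ (mapsTo_pose Δ hΔ (subset_closure ⟨q, hq, rfl⟩))
    -- For directions between arbitrary vertices: the model is `alpha` of a configuration with the
    -- same positions as q, hence of q itself.
    obtain ⟨q', hq'⟩ := exists_alpha_eq_model Δ ⟨_, hO⟩ (q.1 0) hs
    have hqq : q = q' := Subtype.ext (((congrArg Prod.fst hq').trans
      (funext fun i => (hpos i).symm)).symm)
    intro t
    rw [← hqq] at hq'
    exact congrArg (fun x : Amb (k + 1) k => (x.2.1 t : E k)) hq'

end Model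

/-! ### The inscribed simplices -/

section Inscribed

variable {k : ℕ} {Δ : Conf (k + 1) k}

theorem inner_dir_eq_mulVec (b : E k) (j : Fin k) :
    inner ℝ b (dir Δ ⟨(j.succ, 0), Fin.succ_ne_zero j⟩ : E k) =
      ((Pi (alpha Δ)).transpose.mulVec b) j := by
  simp [PiLp.inner_apply, Matrix.mulVec, dotProduct, Pi, alpha]

theorem isUnit_det_Pi_transpose (hΔ : AffineIndependent ℝ Δ.1) :
    IsUnit (Pi (alpha Δ)).transpose.det := by
  rw [Matrix.det_transpose]
  exact isUnit_iff_ne_zero.2 (det_Pi_ne_zero Δ hΔ)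

theorem eq_of_inner_dir_eq (hΔ : AffineIndependent ℝ Δ.1) {b c : E k}
    (h : ∀ j : Fin k, inner ℝ b (dir Δ ⟨(j.succ, 0), Fin.succ_ne_zero j⟩ : E k) =
      inner ℝ c (dir Δ ⟨(j.succ, 0), Fin.succ_ne_zero j⟩ : E k)) : b = c := by
  have h' : (Pi (alpha Δ)).transpose.mulVec b = (Pi (alpha Δ)).transpose.mulVec c :=
    funext fun j => by rw [← inner_dir_eq_mulVec, ← inner_dir_eq_mulVec, h]
  exact PiLp.ext (congrFun (Matrix.mulVec_injective_of_isUnit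
    ((Matrix.isUnit_iff_isUnit_det _).2 (isUnit_det_Pi_transpose hΔ)) h'))

variable (Δ) in
/-- The vector from the circumcenter of `Δ` to the vertex `Δ₀`. -/
def circumVec : E k :=
  WithLp.toLp 2 ((Pi (alpha Δ)).transpose⁻¹.mulVec fun j => -‖Δ.1 j.succ - Δ.1 0‖ / 2)

/-- For the unit direction u and length ℓ of an edge at Δ₀, the equation ‖w + ℓu‖ = ‖w‖ is
equivalent to ⟨w, u⟩ = −ℓ/2. The circumcenter thus solves a linear system with invertible matrix
Π(Δ)ᵀ. -/
theorem inner_circumVec_dir (hΔ : AffineIndependent ℝ Δ.1) (j : Fin k) :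
    inner ℝ (circumVec Δ) (dir Δ ⟨(j.succ, 0), Fin.succ_ne_zero j⟩ : E k) =
      -‖Δ.1 j.succ - Δ.1 0‖ / 2 := by
  rw [inner_dir_eq_mulVec, circumVec, Matrix.mulVec_mulVec,
    Matrix.mul_nonsing_inv _ (isUnit_det_Pi_transpose hΔ), Matrix.one_mulVec]

theorem norm_circumVec_pos (hk : 1 ≤ k) (hΔ : AffineIndependent ℝ Δ.1) :
    0 < ‖circumVec Δ‖ := by
  refine norm_pos_iff.2 fun h => ?_
  have h1 := inner_circumVec_dir hΔ ⟨0, hk⟩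
  rw [h, inner_zero_left] at h1
  have h2 := norm_sub_pos Δ (Fin.succ_ne_zero (⟨0, hk⟩ : Fin k))
  linarith

theorem norm_circumVec_add (hΔ : AffineIndependent ℝ Δ.1) (i : Fin (k + 1)) :
    ‖circumVec Δ + (Δ.1 i - Δ.1 0)‖ = ‖circumVec Δ‖ := by
  refine Fin.cases (by simp) (fun j => ?_) i
  have h1 := norm_smul_dir Δ ⟨(j.succ, 0), Fin.succ_ne_zero j⟩
  simp only at h1
  rw [← sq_eq_sq₀ (norm_nonneg _) (norm_nonneg _), norm_add_sq_real]
  nth_rw 1 [← h1]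
  rw [inner_smul_right, inner_circumVec_dir hΔ]
  ring

variable (Δ) in
/-- The simplex similar to `Δ` with rotation `U` and inscribed in the unit sphere. -/
def inscribed (U : O k) : Amb (k + 1) k :=
  model Δ U (‖circumVec Δ‖⁻¹ • U.1.toEuclideanLin (circumVec Δ)) ‖circumVec Δ‖⁻¹

theorem pos_inscribed (U : O k) (i : Fin (k + 1)) : pos (inscribed Δ U) i =
    ‖circumVec Δ‖⁻¹ • U.1.toEuclideanLin (circumVec Δ + (Δ.1 i - Δ.1 0)) := by
  rw [map_add, smul_add]
  rfl

theorem continuous_inscribed : Continuous (inscribed Δ) := by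
  have h : Continuous fun U : O k => U.1.toEuclideanLin (circumVec Δ) :=
    (continuous_toEuclideanLin _).comp continuous_subtype_val
  exact (continuous_model Δ).comp
    (continuous_id.prodMk ((h.const_smul ‖circumVec Δ‖⁻¹).prodMk continuous_const))

theorem inscribed_mem_range (hk : 1 ≤ k) (hΔ : AffineIndependent ℝ Δ.1) (U : O k) :
    ∃ q : Conf (k + 1) k, alpha q = inscribed Δ U :=
  exists_alpha_eq_model Δ U _ (inv_pos.2 (norm_circumVec_pos hk hΔ))

theorem inscribed_mem_sphereConf (hk : 1 ≤ k) (hΔ : AffineIndependent ℝ Δ.1) (U : O k) :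
    inscribed Δ U ∈ sphereConf k := by
  have hpos : ∀ i, pos (inscribed Δ U) i ∈ Metric.sphere (0 : E k) 1 := by
    intro i
    rw [mem_sphere_zero_iff_norm, pos_inscribed, norm_smul, norm_toEuclideanLin U.2,
      norm_circumVec_add hΔ, norm_inv, norm_norm,
      inv_mul_cancel₀ (norm_circumVec_pos hk hΔ).ne']
  obtain ⟨q, hq⟩ := inscribed_mem_range hk hΔ U
  refine ⟨subset_closure ⟨q, fun i => ?_, hq⟩, hpos⟩
  have := hpos i
  rwa [← hq] at this

/-- A limit of chords of the sphere is orthogonal to the sum of the limits of their ends. -/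
theorem inner_dir_pos_add_eq_zero {n : ℕ} {x : Amb n k}
    (hx : x ∈ compactConf n (Metric.sphere (0 : E k) 1)) (t : Pairs n) :
    inner ℝ (x.2.1 t : E k) (pos x t.1.1 + pos x t.1.2) = 0 := by
  have hc : IsClosed {x : Amb n k | inner ℝ (x.2.1 t : E k) (pos x t.1.1 + pos x t.1.2) = 0} := by
    refine isClosed_eq ?_ continuous_const
    unfold pos
    fun_prop
  refine closure_minimal ?_ hc hx.1
  rintro _ ⟨q, hq, rfl⟩
  change inner ℝ (‖q.1 t.1.1 - q.1 t.1.2‖⁻¹ • (q.1 t.1.1 - q.1 t.1.2))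
    (q.1 t.1.1 + q.1 t.1.2) = 0
  rw [inner_smul_left, real_inner_comm,
    (real_inner_add_sub_eq_zero_iff _ _).2 (by
      rw [mem_sphere_zero_iff_norm.1 (hq t.1.1), mem_sphere_zero_iff_norm.1 (hq t.1.2)]), mul_zero]

/-- Every inscribed simplex similar to `Δ` is determined by its rotation. -/
theorem eq_inscribed (hk : 1 ≤ k) (hΔ : AffineIndependent ℝ Δ.1) {x : Amb (k + 1) k}
    (hx : x ∈ sim Δ) (hs : x ∈ sphereConf k) :
    x = inscribed Δ ⟨frame Δ x, frame_mem_O hΔ (mapsTo_pose Δ hΔ hx)⟩ := by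
  have hO := frame_mem_O hΔ (mapsTo_pose Δ hΔ hx)
  have hm := eq_model_of_mem_sim hk hΔ hx
  set s := scale Δ x
  set a := pos x 0
  -- Orthogonality of the chord direction Uu to the sum of its ends reads 2⟨a, Uu⟩ + sℓ = 0, which
  -- is s times the system for `circumVec`. Unlike ‖pⱼ‖ = 1, this condition keeps its content when s
  -- = 0.
  have ha : (frame Δ x).transpose.toEuclideanLin a = s • circumVec Δ := by
    refine eq_of_inner_dir_eq hΔ fun j => ?_
    have h := inner_dir_pos_add_eq_zero hs ⟨(j.succ, 0), Fin.succ_ne_zero j⟩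
    have h1 := norm_smul_dir Δ ⟨(j.succ, 0), Fin.succ_ne_zero j⟩
    simp only at h1 h
    have hp : pos x j.succ = a + s • (frame Δ x).toEuclideanLin (Δ.1 j.succ - Δ.1 0) :=
      congrFun (congrArg Prod.fst hm) j.succ
    rw [hp, ← h1, ← frame_dir hΔ, map_smul, inner_add_right, inner_add_right, inner_smul_right,
      inner_smul_right, inner_toEuclideanLin hO, real_inner_self_eq_norm_sq,
      norm_eq_of_mem_sphere, inner_toEuclideanLin_left] at h
    rw [inner_smul_left, inner_circumVec_dir hΔ, real_inner_comm]
    simp only [conj_trivial]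
    linarith
  -- The first vertex lies on the unit sphere; in particular s cannot vanish.
  have hnorm : s * ‖circumVec Δ‖ = 1 := by
    have h1 : ‖a‖ = 1 := mem_sphere_zero_iff_norm.1 (hs.2 0)
    rw [← norm_toEuclideanLin (transpose_mem_O hO), ha, norm_smul,
      Real.norm_of_nonneg (scale_nonneg Δ x)] at h1
    exact h1
  have hs' : s = ‖circumVec Δ‖⁻¹ := eq_inv_of_mul_eq_one_left hnorm
  have ha' : a = ‖circumVec Δ‖⁻¹ • (frame Δ x).toEuclideanLin (circumVec Δ) := by
    rw [← hs', ← map_smul, ← ha, ← toEuclideanLin_mul_apply, mul_transpose_of_mem_O hO]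
    simp
  exact hm.trans (congrArg₂ (model Δ _) ha' hs')

end Inscribed

/-! ### The pose map on the simplices with pose in a given set of orthogonal matrices -/

section PoseMap

variable {k : ℕ} {Δ : Conf (k + 1) k} {Y : Set (Amb (k + 1) k)}
  {T : Set (Matrix (Fin k) (Fin k) ℝ)}

/-- The rotation carrying `Δ` to the simplices with pose `A`. -/
def rotation (hΔ : AffineIndependent ℝ Δ.1) (hT : T ⊆ O k) (A : T) : O k :=
  ⟨A.1 * (pose Δ (alpha Δ)).transpose,
    mul_mem_O (hT A.2) (transpose_mem_O (pose_alpha_mem_O hΔ))⟩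

theorem continuous_rotation (hΔ : AffineIndependent ℝ Δ.1) (hT : T ⊆ O k) :
    Continuous (rotation hΔ hT) :=
  (continuous_subtype_val.matrix_mul continuous_const).subtype_mk _

theorem rotation_mul (hΔ : AffineIndependent ℝ Δ.1) (hT : T ⊆ O k) (A : T) :
    (rotation hΔ hT A).1 * pose Δ (alpha Δ) = A.1 := by
  rw [rotation, Matrix.mul_assoc, transpose_mul_of_mem_O (pose_alpha_mem_O hΔ), Matrix.mul_one]

theorem pose_model_rotation (hΔ : AffineIndependent ℝ Δ.1) (hT : T ⊆ O k) (A : T) (a : E k)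
    (s : ℝ) : pose Δ (model Δ (rotation hΔ hT A) a s) = A.1 := by
  rw [pose_model, rotation_mul]

theorem model_rotation_mem (hΔ : AffineIndependent ℝ Δ.1) (hT : T ⊆ O k)
    (hY : ∀ x, x ∈ Y ↔ x ∈ sim Δ ∧ pose Δ x ∈ T) (A : T) (a : E k) {s : ℝ} (hs : 0 ≤ s) :
    model Δ (rotation hΔ hT A) a s ∈ Y :=
  (hY _).2 ⟨model_mem_sim Δ _ _ hs, by rw [pose_model_rotation]; exact A.2⟩

/-- The inscribed simplices are homeomorphic to the set of their poses. -/
def poseHomeomorph (hk : 1 ≤ k) (hΔ : AffineIndependent ℝ Δ.1) (hT : T ⊆ O k)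
    (hY : ∀ x, x ∈ Y ↔ x ∈ sim Δ ∧ pose Δ x ∈ T) :
    (Y ∩ sphereConf k : Set (Amb (k + 1) k)) ≃ₜ T where
  toFun x := ⟨pose Δ x.1, ((hY _).1 x.2.1).2⟩
  invFun A := ⟨inscribed Δ (rotation hΔ hT A),
    model_rotation_mem hΔ hT hY A _ (by positivity), inscribed_mem_sphereConf hk hΔ _⟩
  left_inv x := Subtype.ext (eq_inscribed hk hΔ ((hY _).1 x.2.1).1 x.2.2).symm
  right_inv A := Subtype.ext (pose_model_rotation hΔ hT A _ _)
  continuous_toFun := ((continuous_pose Δ).comp continuous_subtype_val).subtype_mk _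
  continuous_invFun := (continuous_inscribed.comp (continuous_rotation hΔ hT)).subtype_mk _

theorem coe_poseHomeomorph (hk : 1 ≤ k) (hΔ : AffineIndependent ℝ Δ.1) (hT : T ⊆ O k)
    (hY : ∀ x, x ∈ Y ↔ x ∈ sim Δ ∧ pose Δ x ∈ T)
    (h : Set.MapsTo (pose Δ) (Y ∩ sphereConf k) T) :
    (poseHomeomorph hk hΔ hT hY : C((Y ∩ sphereConf k : Set (Amb (k + 1) k)), T)) =
      poseMap Δ h :=
  rfl

theorem isIso_Hmap_poseMap (hk : 1 ≤ k) (hΔ : AffineIndependent ℝ Δ.1) (hT : T ⊆ O k)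
    (hY : ∀ x, x ∈ Y ↔ x ∈ sim Δ ∧ pose Δ x ∈ T)
    (h : Set.MapsTo (pose Δ) (Y ∩ sphereConf k) T) (n : ℕ) : IsIso (Hmap n (poseMap Δ h)) :=
  coe_poseHomeomorph hk hΔ hT hY h ▸ isIso_Hmap_homeomorph n (poseHomeomorph hk hΔ hT hY)

/-- The simplices with pose in `T` retract by deformation onto the inscribed ones: move the
first vertex and the scale along segments. -/
theorem isIso_Hmap_incl (hk : 1 ≤ k) (hΔ : AffineIndependent ℝ Δ.1) (hT : T ⊆ O k)
    (hY : ∀ x, x ∈ Y ↔ x ∈ sim Δ ∧ pose Δ x ∈ T) (n : ℕ) : IsIso (Hmap n (incl Y)) := by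
  let e := poseHomeomorph hk hΔ hT hY
  let p : C(Y, T) := poseMap Δ fun x hx => ((hY x).1 hx).2
  let g : C(Y, (Y ∩ sphereConf k : Set (Amb (k + 1) k))) :=
    (e.symm : C(T, (Y ∩ sphereConf k : Set (Amb (k + 1) k)))).comp p
  let U : Y → O k := fun x => rotation hΔ hT (p x)
  have hU : Continuous U := (continuous_rotation hΔ hT).comp p.continuous
  let c : Y → E k := fun x => ‖circumVec Δ‖⁻¹ • (U x).1.toEuclideanLin (circumVec Δ)
  have hact : Continuous fun x => (U x).1.toEuclideanLin (circumVec Δ) :=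
    (continuous_toEuclideanLin _).comp (continuous_subtype_val.comp hU)
  have hc : Continuous c := hact.const_smul ‖circumVec Δ‖⁻¹
  have hgf : g.comp (incl Y) = ContinuousMap.id _ := ContinuousMap.ext e.symm_apply_apply
  refine isIso_Hmap_of_homotopic n (g := g) (hgf ▸ ContinuousMap.Homotopic.refl _) ?_
  -- The pose stays fixed while (a, s) moves from its inscribed value at time 0 to its value for x
  -- at time 1. The scale stays nonnegative by convexity, so the path remains in Y.
  let F : unitInterval × Y → Amb (k + 1) k := fun q =>
    model Δ (U q.2) ((1 - q.1.1) • c q.2 + q.1.1 • pos q.2.1 0)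
      ((1 - q.1.1) * ‖circumVec Δ‖⁻¹ + q.1.1 * scale Δ q.2.1)
  have hF : Continuous F := by
    have ht : Continuous fun q : unitInterval × Y => q.1.1 :=
      continuous_subtype_val.comp continuous_fst
    have hx : Continuous fun q : unitInterval × Y => q.2.1 :=
      continuous_subtype_val.comp continuous_snd
    exact (continuous_model Δ).comp ((hU.comp continuous_snd).prodMk
      ((((continuous_const.sub ht).smul (hc.comp continuous_snd)).add
        (ht.smul ((continuous_pos 0).comp hx))).prodMk
        (((continuous_const.sub ht).mul continuous_const).add
          (ht.mul ((continuous_scale Δ).comp hx)))))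
  have hFY : ∀ q, F q ∈ Y := fun q => model_rotation_mem hΔ hT hY _ _
    (add_nonneg (mul_nonneg (sub_nonneg.2 q.1.2.2) (by positivity))
      (mul_nonneg q.1.2.1 (scale_nonneg Δ _)))
  refine ⟨⟨⟨fun q => ⟨F q, hFY q⟩, hF.subtype_mk _⟩, fun x => Subtype.ext ?_,
    fun x => Subtype.ext ?_⟩⟩
  · change model Δ (U x) ((1 - (0 : ℝ)) • c x + (0 : ℝ) • pos x.1 0)
      ((1 - (0 : ℝ)) * ‖circumVec Δ‖⁻¹ + (0 : ℝ) * scale Δ x.1) = model Δ (U x) (c x) _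
    simp
  · change model Δ (U x) ((1 - (1 : ℝ)) • c x + (1 : ℝ) • pos x.1 0)
      ((1 - (1 : ℝ)) * ‖circumVec Δ‖⁻¹ + (1 : ℝ) * scale Δ x.1) = x.1
    rw [sub_self, zero_smul, zero_mul, one_smul, one_mul, zero_add, zero_add]
    exact (eq_model_of_mem_sim hk hΔ ((hY _).1 x.2).1).symm

variable (Δ) in
/-- The positions of the vertices of the inscribed simplex with pose `M`, as a function on all
matrices. -/
def vertices (M : Fin k → Fin k → ℝ) : Fin (k + 1) → E k := fun i =>
  ‖circumVec Δ‖⁻¹ • (Matrix.of M * (pose Δ (alpha Δ)).transpose).toEuclideanLin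
    (circumVec Δ + (Δ.1 i - Δ.1 0))

theorem contDiff_vertices : ContDiff ℝ ∞ (vertices Δ) := by
  refine contDiff_pi.2 fun i => contDiff_piLp' 2 fun a => ?_
  simp only [vertices, PiLp.smul_apply, smul_eq_mul, Matrix.toLpLin_apply, Matrix.mulVec, dotProduct, Matrix.mul_apply, Matrix.of_apply]
  fun_prop

variable (Δ) in
/-- The pose of an inscribed simplex in terms of its vertices, as a function on all tuples of
points. -/
def poseOfVertices (p : Fin (k + 1) → E k) : Fin k → Fin k → ℝ := fun a b =>
  (Matrix.of (fun (i j : Fin k) => ‖circumVec Δ‖ * (‖Δ.1 j.succ - Δ.1 0‖⁻¹ * (p j.succ i - p 0 i))) *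
    (P Δ)⁻¹) a b

theorem contDiff_poseOfVertices : ContDiff ℝ ∞ (poseOfVertices Δ) := by
  refine contDiff_pi.2 fun a => contDiff_pi.2 fun b => ?_
  simp only [poseOfVertices, Matrix.mul_apply, Matrix.of_apply]
  fun_prop

theorem positions_eq_vertices (hk : 1 ≤ k) (hΔ : AffineIndependent ℝ Δ.1) (hT : T ⊆ O k)
    (hY : ∀ x, x ∈ Y ↔ x ∈ sim Δ ∧ pose Δ x ∈ T)
    (x : (Y ∩ sphereConf k : Set (Amb (k + 1) k))) :
    positions x = vertices Δ (entries (poseHomeomorph hk hΔ hT hY x)) := by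
  funext i
  have h := congrArg (fun y => pos y i) (eq_inscribed hk hΔ ((hY _).1 x.2.1).1 x.2.2)
  exact h.trans (pos_inscribed _ i)

theorem poseOfVertices_positions (hk : 1 ≤ k) (hΔ : AffineIndependent ℝ Δ.1) (hT : T ⊆ O k)
    (hY : ∀ x, x ∈ Y ↔ x ∈ sim Δ ∧ pose Δ x ∈ T)
    (x : (Y ∩ sphereConf k : Set (Amb (k + 1) k))) :
    poseOfVertices Δ (positions x) = entries (poseHomeomorph hk hΔ hT hY x) := by
  have hx := ((hY _).1 x.2.1).1
  have hw := (norm_circumVec_pos hk hΔ).ne'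
  -- In an inscribed simplex the edge from vertex 0 to vertex j has the fixed length ‖Δⱼ − Δ₀‖/R.
  -- Normalizing it is multiplication by a constant, so the pose is linear in the vertices.
  have key : Matrix.of (fun (i j : Fin k) => ‖circumVec Δ‖ *
      (‖Δ.1 j.succ - Δ.1 0‖⁻¹ * (positions x j.succ i - positions x 0 i))) = Pi x.1 := by
    ext i j
    have hj := (norm_sub_pos Δ (Fin.succ_ne_zero j)).ne'
    have h (l) : positions x l = ‖circumVec Δ‖⁻¹ • (frame Δ x.1).toEuclideanLin (circumVec Δ) +
        ‖circumVec Δ‖⁻¹ • (frame Δ x.1).toEuclideanLin (Δ.1 l - Δ.1 0) :=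
      congrArg (fun y => pos y l) (eq_inscribed hk hΔ hx x.2.2)
    have h1 : positions x j.succ - positions x 0 = ‖circumVec Δ‖⁻¹ • ‖Δ.1 j.succ - Δ.1 0‖ •
        (x.1.2.1 ⟨(j.succ, 0), Fin.succ_ne_zero j⟩ : E k) := by
      have h2 := norm_smul_dir Δ ⟨(j.succ, 0), Fin.succ_ne_zero j⟩
      simp only at h2
      rw [h j.succ, h 0, add_sub_add_left_eq_sub, sub_self, map_zero, smul_zero, sub_zero,
        ← frame_dir hΔ, ← map_smul _ ‖Δ.1 j.succ - Δ.1 0‖, h2]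
    have h3 : positions x j.succ i - positions x 0 i = ‖circumVec Δ‖⁻¹ * (‖Δ.1 j.succ - Δ.1 0‖ *
        (x.1.2.1 ⟨(j.succ, 0), Fin.succ_ne_zero j⟩ : E k) i) := congrArg (fun v : E k => v i) h1
    rw [Matrix.of_apply, h3, Pi, Matrix.of_apply]
    field_simp
  funext a b
  rw [poseOfVertices, key]
  rfl

/-- The hypothesis `hdet` says that T is a union of determinant classes of O(k), which is what the
Cayley charts need. Both SO(k) and its complement qualify. -/
theorem poseResult (hk : 1 ≤ k) (hΔ : AffineIndependent ℝ Δ.1) (hT : T ⊆ O k)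
    (hdet : ∀ A ∈ T, ∀ B ∈ O k, B.det = A.det → B ∈ T)
    (hY : ∀ x, x ∈ Y ↔ x ∈ sim Δ ∧ pose Δ x ∈ T) (h : Set.MapsTo (pose Δ) Y T) :
    PoseResult Δ Y T h where
  subset_interior x hx := by
    rw [eq_inscribed hk hΔ ((hY x).1 hx.1).1 hx.2]
    exact inscribed_mem_range hk hΔ _
  source_manifold := (isSmoothSubmanifold_entries hT hdet).of_homeomorph
    (poseHomeomorph hk hΔ hT hY) contDiff_vertices contDiff_poseOfVertices
    (positions_eq_vertices hk hΔ hT hY) (poseOfVertices_positions hk hΔ hT hY)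
  target_manifold := isSmoothSubmanifold_entries hT hdet
  diffeo := isDiffeo_of_homeomorph (poseHomeomorph hk hΔ hT hY) contDiff_vertices
    contDiff_poseOfVertices (positions_eq_vertices hk hΔ hT hY)
    (poseOfVertices_positions hk hΔ hT hY)
  homology_iso := isIso_Hmap_poseMap hk hΔ hT hY _
  incl_iso := isIso_Hmap_incl hk hΔ hT hY
  top_class c := by
    -- Passing through Y does not change the map: the composite is the pose homeomorphism, which
    -- preserves top classes.
    have hcomp : (poseMap Δ h).comp (incl Y) =
        (poseHomeomorph hk hΔ hT hY : C((Y ∩ sphereConf k : Set (Amb (k + 1) k)), T)) := rfl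
    rw [isTopClass_homeomorph_iff _ (poseHomeomorph hk hΔ hT hY) c, ← hcomp, Hmap_comp]
    rfl

end PoseMap

/-! ### The cases O(k), SO(k) and O(k) \ SO(k) -/

theorem mem_SO_iff {k : ℕ} {A : Matrix (Fin k) (Fin k) ℝ} : A ∈ SO k ↔ A ∈ O k ∧ A.det = 1 :=
  Matrix.mem_specialOrthogonalGroup_iff

end InscribedSimplex

end

open InscribedSimplex in
theorem mainTheorem8 (k : ℕ) (hk : 1 ≤ k) (Δ : Conf (k + 1) k) (hΔ : AffineIndependent ℝ Δ.1) :
    (∀ n : ℕ,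
      IsIso (Hmap n (poseMap Δ
        ((mapsTo_pose Δ hΔ).mono_left (Set.inter_subset_left (t := sphereConf k))))) ∧
      IsIso (Hmap n (incl (sim Δ)))) ∧
    PoseResult Δ (simPlus Δ) (SO k) (mapsTo_pose_plus Δ) ∧
    PoseResult Δ (simMinus Δ) (O k \ SO k) (mapsTo_pose_minus Δ hΔ) := by
  have hsim : ∀ x, x ∈ sim Δ ↔ x ∈ sim Δ ∧ pose Δ x ∈ O k :=
    fun x => ⟨fun hx => ⟨hx, mapsTo_pose Δ hΔ hx⟩, fun hx => hx.1⟩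
  refine ⟨fun n => ⟨isIso_Hmap_poseMap hk hΔ subset_rfl hsim _ n,
    isIso_Hmap_incl hk hΔ subset_rfl hsim n⟩, ?_, ?_⟩
  · exact poseResult hk hΔ (fun A hA => (mem_SO_iff.1 hA).1)
      (fun A hA B hB h => mem_SO_iff.2 ⟨hB, h.trans (mem_SO_iff.1 hA).2⟩) (fun x => Iff.rfl) _
  · refine poseResult hk hΔ Set.sdiff_subset
      (fun A hA B hB h => ⟨hB, fun hB' => hA.2 (mem_SO_iff.2 ⟨hA.1, ?_⟩)⟩) (fun x => ?_) _
    · rw [← h]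
      exact (mem_SO_iff.1 hB').2
    · exact ⟨fun hx => ⟨hx.1, mapsTo_pose_minus Δ hΔ hx⟩,
        fun hx => ⟨hx.1, fun hx' => hx.2.2 hx'.2⟩⟩
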